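/- **Theorem.** Let $1\le r<\infty$, let $X=\ell_r(\mathbb Z_+)$ be the real sequence space, and let $u=(u_n)_{n\ge1}$ and $v=(v_n)_{n\ge 1}$ be bounded sequences of positive real numbers. For such a sequence $w$ let $B_w:X\to X$ be the weighted backward shift, $B_we_0=0$ and $B_we_n=w_ne_{n-1}$ for $n\ge1$. Let $m_u=\bigotimes_{n\ge0}\mu_{u,n}$ and $m_v=\bigotimes_{n\ge0}\mu_{v,n}$ be product probability measures on $X$ (that is, the $\mu_{u,n},\mu_{v,n}$ are Borel probability measures on $\mathbb R$, and $m_u$, $m_v$ are the restrictions to $X$ of the corresponding product measures on $\mathbb R^{\mathbb Z_+}$, which give $X$ measure $1$), and suppose that $m_u$ is $B_u$-invariant and $m_v$ is $B_v$-invariant. Assume that $\mu_{u,0}=\mathtt p(t)\,dt$ and $\mu_{v,0}=\mathtt q(t)\,dt$ are absolutely continuous with respect to Lebesgue measure, with densities $\mathtt p,\mathtt q\ge0$. Put $\lambda_n=\dfrac{u_1\cdots u_n}{v_1\cdots v_n}$ and $f=\sqrt{\mathtt p}$. "Orthogonal" means mutually singular. 1. If $m_u$ and $m_v$ are not orthogonal,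 then $\lambda_n$ has a limit $a\in(0,\infty)$ as $n\to\infty$, $\mathtt q(t)=a\,\mathtt p(at)$ for almost every $t$, and $\sum_{n=1}^\infty\left(1-\frac1a\lambda_n\right)^2<\infty$. 2. Assume that $f$ is continuous on $\mathbb R\setminus\{0\}$ and $C^1$ except at finitely many points, that $t f'(t)\in L_2(\mathbb R)$, and that $\mathtt q(t)=a\,\mathtt p(at)$ almost everywhere for some $a\in(0,\infty)$. Then $m_u$ and $m_v$ are non-orthogonal if and only if $\mu_{u,n}$ and $\mu_{v,n}$ are non-orthogonal for every $n\ge0$ and $\sum_{n=1}^\infty\left(1-\frac1a\lambda_n\right)^2<\infty$. 3. Assume that $f$ is $C^1$ except at finitely many points, that $t f'(t)\in L_2(\mathbb R)$, that $\mathtt p$ has at least one non-removable discontinuity at a point of $\mathbb R\setminus\{0\}$ (a point $t_0\neq0$ such that $\mathtt p(t)$ has no finite limit as $t\to t_0$, $t\ne t_0$), and that $\mathtt q(t)=a\,\mathtt p(at)$ almost everywhere for some $a\in(0,\infty)$. Then $m_u$ and $m_v$ are non-orthogonal if and only if $\mu_{u,n}$ and $\mu_{v,n}$ are non-orthogonal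 for every $n\ge0$ and $\sum_{n=1}^\infty\left|1-\frac1a\lambda_n\right|<\infty$. -/

import Mathlib

open MeasureTheory Filter Topology
open scoped ENNReal

/-- A positive weight sequence `(w_n)_{n ≥ 1}`: a bounded sequence of positive reals.  It is stored
as a function on `ℕ` whose value at `0` is never used. -/
structure IsPositiveWeight (w : ℕ → ℝ) : Prop where
  pos : ∀ n, 1 ≤ n → 0 < w n
  bdd : ∃ C, ∀ n, 1 ≤ n → w n ≤ C

/-- The real sequence space `ℓ_r(ℤ_+)`. -/
abbrev RealEll (r : ℝ≥0∞) : Type := lp (fun _ : ℕ => ℝ) r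

/-- `ℓ_r` carries the Borel `σ`-algebra of its norm. -/
noncomputable instance RealEll.measurableSpace (r : ℝ≥0∞) [Fact (1 ≤ r)] : MeasurableSpace (RealEll r) :=
  borel (RealEll r)

instance RealEll.borelSpace (r : ℝ≥0∞) [Fact (1 ≤ r)] : BorelSpace (RealEll r) := ⟨rfl⟩

theorem exists_shift_bound {r : ℝ≥0∞} [Fact (1 ≤ r)] {w : ℕ → ℝ} (hw : IsPositiveWeight w) :
    ∃ C : ℝ, 0 ≤ C ∧ ∀ (x : RealEll r) (n : ℕ),
      ‖w (n + 1) * x (n + 1)‖ ≤ ‖C * x (n + 1)‖ := by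
  obtain ⟨C, hC⟩ := hw.bdd
  have h0 : 0 ≤ C := (hw.pos 1 le_rfl).le.trans (hC 1 le_rfl)
  refine ⟨C, h0, fun x n => ?_⟩
  rw [norm_mul, norm_mul, Real.norm_of_nonneg h0,
    Real.norm_of_nonneg (hw.pos (n + 1) (Nat.le_add_left 1 n)).le]
  exact mul_le_mul_of_nonneg_right (hC _ (Nat.le_add_left 1 n)) (norm_nonneg _)

theorem memℓp_backwardShift {r : ℝ≥0∞} [Fact (1 ≤ r)] {w : ℕ → ℝ} (hw : IsPositiveWeight w)
    (x : RealEll r) : Memℓp (fun n => w (n + 1) * x (n + 1)) r := by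
  obtain ⟨C, -, hC⟩ := exists_shift_bound (r := r) hw
  have hr : r ≠ 0 := (zero_lt_one.trans_le (Fact.out : 1 ≤ r)).ne'
  have hx : Memℓp (fun n => C * x n) r := (lp.memℓp x).const_mul C
  rcases eq_or_ne r ∞ with rfl | htop
  · rw [memℓp_infty_iff] at hx ⊢
    obtain ⟨D, hD⟩ := hx
    refine ⟨D, ?_⟩
    rintro _ ⟨n, rfl⟩
    exact (hC x n).trans (hD ⟨n + 1, rfl⟩)
  · have hpos : 0 < r.toReal := ENNReal.toReal_pos hr htop
    rw [memℓp_gen_iff hpos] at hx ⊢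
    refine Summable.of_nonneg_of_le (fun n => by positivity) (fun n => ?_)
      ((summable_nat_add_iff 1).2 hx)
    exact Real.rpow_le_rpow (norm_nonneg _) (hC x n) hpos.le

/-- The linear map underlying the weighted backward shift. -/
noncomputable def backwardShiftLinear (r : ℝ≥0∞) [Fact (1 ≤ r)] (w : ℕ → ℝ)
    (hw : IsPositiveWeight w) : RealEll r →ₗ[ℝ] RealEll r where
  toFun x := ⟨fun n => w (n + 1) * x (n + 1), memℓp_backwardShift hw x⟩
  map_add' x y := by
    ext n
    exact mul_add _ _ _
  map_smul' c x := by
    ext n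
    exact mul_left_comm _ _ _

theorem backwardShiftLinear_bound {r : ℝ≥0∞} [Fact (1 ≤ r)] {w : ℕ → ℝ}
    (hw : IsPositiveWeight w) :
    ∃ C : ℝ, ∀ x : RealEll r, ‖backwardShiftLinear r w hw x‖ ≤ C * ‖x‖ := by
  obtain ⟨C, h0, hC⟩ := exists_shift_bound (r := r) hw
  have hr : r ≠ 0 := (zero_lt_one.trans_le (Fact.out : 1 ≤ r)).ne'
  refine ⟨C, fun x => ?_⟩
  have hnorm : C * ‖x‖ = ‖C • x‖ := by rw [norm_smul, Real.norm_of_nonneg h0]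
  rw [hnorm]
  rcases eq_or_ne r ∞ with rfl | htop
  · exact lp.norm_le_of_forall_le (norm_nonneg _) fun n =>
      (hC x n).trans (lp.norm_apply_le_norm hr (C • x) (n + 1))
  · have hpos : 0 < r.toReal := ENNReal.toReal_pos hr htop
    have hs : Summable fun n => ‖(C • x : RealEll r) n‖ ^ r.toReal :=
      (memℓp_gen_iff hpos).1 (lp.memℓp (C • x))
    have hs1 := (summable_nat_add_iff 1).2 hs
    have hB : Summable fun n => ‖backwardShiftLinear r w hw x n‖ ^ r.toReal :=
      (memℓp_gen_iff hpos).1 (lp.memℓp _)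
    refine lp.norm_le_of_tsum_le hpos (norm_nonneg _) ?_
    rw [lp.norm_rpow_eq_tsum hpos (C • x), hs.tsum_eq_zero_add]
    have h1 : ∑' n, ‖backwardShiftLinear r w hw x n‖ ^ r.toReal ≤
        ∑' n, ‖(C • x : RealEll r) (n + 1)‖ ^ r.toReal :=
      hB.tsum_le_tsum (fun n => Real.rpow_le_rpow (norm_nonneg _) (hC x n) hpos.le) hs1
    have h2 : 0 ≤ ‖(C • x : RealEll r) 0‖ ^ r.toReal := by positivity
    linarith

/-- The weighted backward shift `B_w` on `ℓ_r`, the bounded operator with `B_w e_0 = 0` and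
`B_w e_n = w_n e_{n-1}` for `n ≥ 1`; in coordinates, `(B_w x)_n = w_{n+1} x_{n+1}`. -/
noncomputable def backwardShift (r : ℝ≥0∞) [Fact (1 ≤ r)] (w : ℕ → ℝ)
    (hw : IsPositiveWeight w) : RealEll r →L[ℝ] RealEll r :=
  (backwardShiftLinear r w hw).mkContinuousOfExistsBound (backwardShiftLinear_bound hw)

/-- `m = ⊗_{n ≥ 0} μ_n` as a measure on `ℓ_r`: regarded as a measure on `ℝ^{ℤ_+}` through the
inclusion `ℓ_r ⊆ ℝ^{ℤ_+}`, the measure `m` is the product of the probability measures `μ_n`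
(which therefore gives `ℓ_r` full measure). -/
def IsProductMeasure {r : ℝ≥0∞} [Fact (1 ≤ r)] (m : Measure (RealEll r)) (μ : ℕ → Measure ℝ)
    [∀ n, IsProbabilityMeasure (μ n)] : Prop :=
  m.map (fun (x : RealEll r) (n : ℕ) => x n) = Measure.infinitePi μ

/-- The quotient `λ_n = (u_1 ⋯ u_n) / (v_1 ⋯ v_n)`. -/
noncomputable def weightRatio (u v : ℕ → ℝ) (n : ℕ) : ℝ :=
  (∏ i ∈ Finset.Icc 1 n, u i) / (∏ i ∈ Finset.Icc 1 n, v i)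

/-- `f` is `C¹` on the complement of a finite set of points. -/
def IsC1ExceptFinite (f : ℝ → ℝ) : Prop :=
  ∃ S : Set ℝ, S.Finite ∧ ContDiffOn ℝ 1 f Sᶜ

/-- `p` has a genuine discontinuity at `t`: one which does not disappear when the value of `p` at
the single point `t` is changed. -/
def HasEssentialDiscontinuityAt (p : ℝ → ℝ) (t : ℝ) : Prop :=
  ¬ ∃ l : ℝ, Tendsto p (𝓝[≠] t) (𝓝 l)

/-! Invariance under `B_w` forces the marginal of index `n` to be the image of the marginal of index
`0` under division by `w_1 ⋯ w_n`. On square roots of densities this is the unitary dilation `D_s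
f(t) = e^{s/2} f(e^s t)` of `L²(ℝ)`, with `s = log (w_1 ⋯ w_n)`. Write `f = √p`, `g = √q` and `s_n =
log λ_n`. By unitarity the Hellinger affinity of the marginals of index `n` is `⟨D_{s_n} f, g⟩`, and
since `f` and `g` are unit vectors, `‖D_{s_n} f - g‖² = 2 (1 - ⟨D_{s_n} f, g⟩)`. Kakutani's theorem
then says that the product measures are non-orthogonal iff all pairs of marginals are and `∑
‖D_{s_n} f - g‖² < ∞` (`not_mutuallySingular_iff_summable_dilateLp`). What remains is the geometry
of the orbit `s ↦ D_s f`.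

Part 1 rests on `‖D_s f - D_t f‖ ≥ c min(1, |s - t|)` (`exists_mul_min_le_norm_dilateLp_sub`): a
large dilation makes `f` nearly orthogonal to itself, and a small dilation, repeated, becomes a
large one. Hence `D_{s_n} f → g` forces `s_n` to converge to some `b`, with `g = D_b f` and `∑ (s_n
- b)² < ∞`; put `a = e^b`.

Parts 2 and 3 need the order of `‖D_s f - f‖²` as `s → 0`. When `f` has no jump off `0`, integrating
the generator `f/2 + t f'` along the orbit gives `O(s²)`. A jump at `d ≠ 0` is crossed by a set of
points `t` of measure comparable to `s`, so it contributes exactly order `|s|`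
(`exists_norm_dilateLp_sub_sq_le`, `exists_mul_le_norm_dilateLp_sub_sq`). Finally `1 - λ_n / a = 1 -
e^{s_n - log a}` is comparable to `s_n - log a`. -/

/-! ### Hellinger affinity and mutual singularity -/

section Affinity

variable {α : Type*} [MeasurableSpace α] {ρ : Measure α} {F G : α → ℝ≥0∞}

theorem sq_lintegral_mul_le (hF : AEMeasurable F ρ) (hG : AEMeasurable G ρ) :
    (∫⁻ x, F x * G x ∂ρ) ^ 2 ≤ (∫⁻ x, F x ^ 2 ∂ρ) * ∫⁻ x, G x ^ 2 ∂ρ := by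
  have h := ENNReal.lintegral_mul_le_Lp_mul_Lq ρ Real.HolderConjugate.two_two hF hG
  simp only [Pi.mul_apply, ENNReal.rpow_two] at h
  calc _ ≤ ((∫⁻ x, F x ^ 2 ∂ρ) ^ (1 / 2 : ℝ) * (∫⁻ x, G x ^ 2 ∂ρ) ^ (1 / 2 : ℝ)) ^ 2 := by gcongr
    _ = _ := by
      rw [mul_pow, ← ENNReal.rpow_two, ← ENNReal.rpow_two, ← ENNReal.rpow_mul, ← ENNReal.rpow_mul]
      norm_num

/-- The set `{F ≤ G}` works: there `F² ≤ F G`, and off it `G² ≤ F G`. -/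
theorem exists_measurableSet_withDensity_sq_le (hF : Measurable F) (hG : Measurable G) :
    ∃ A, MeasurableSet A ∧ ρ.withDensity (fun x => F x ^ 2) A ≤ ∫⁻ x, F x * G x ∂ρ ∧
      ρ.withDensity (fun x => G x ^ 2) Aᶜ ≤ ∫⁻ x, F x * G x ∂ρ := by
  have hA : MeasurableSet {x | F x ≤ G x} := measurableSet_le hF hG
  refine ⟨_, hA, ?_, ?_⟩
  · rw [withDensity_apply _ hA]
    refine (setLIntegral_mono (hF.mul hG) fun x hx => ?_).trans (setLIntegral_le_lintegral _ _)
    rw [sq]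
    exact mul_le_mul_right hx _
  · rw [withDensity_apply _ hA.compl]
    refine (setLIntegral_mono (hF.mul hG) fun x hx => ?_).trans (setLIntegral_le_lintegral _ _)
    rw [sq]
    exact mul_le_mul_left (lt_of_not_ge (Set.mem_compl_iff _ _ |>.1 hx)).le _

/-- Cauchy–Schwarz on `A` and on `Aᶜ` separately: on each piece one of the two masses is at most `δ
^ 2` and the other at most `1`. -/
theorem lintegral_mul_le_of_withDensity_sq_le (hF : Measurable F) (hG : Measurable G)
    [IsProbabilityMeasure (ρ.withDensity fun x => F x ^ 2)]
    [IsProbabilityMeasure (ρ.withDensity fun x => G x ^ 2)] {A : Set α} (hA : MeasurableSet A)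
    {δ : ℝ≥0∞} (h1 : ρ.withDensity (fun x => F x ^ 2) A ≤ δ ^ 2)
    (h2 : ρ.withDensity (fun x => G x ^ 2) Aᶜ ≤ δ ^ 2) :
    ∫⁻ x, F x * G x ∂ρ ≤ 2 * δ := by
  rw [← lintegral_add_compl _ hA, two_mul]
  have key : ∀ B, MeasurableSet B → (∫⁻ x in B, F x * G x ∂ρ) ^ 2 ≤
      ρ.withDensity (fun x => F x ^ 2) B * ρ.withDensity (fun x => G x ^ 2) B := fun B hB => by
    rw [withDensity_apply _ hB, withDensity_apply _ hB]
    exact sq_lintegral_mul_le hF.aemeasurable hG.aemeasurable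
  refine add_le_add ?_ ?_
  · refine (ENNReal.pow_le_pow_left_iff two_ne_zero).1 ((key _ hA).trans ?_)
    calc _ ≤ δ ^ 2 * 1 := mul_le_mul' h1 prob_le_one
      _ = _ := mul_one _
  · refine (ENNReal.pow_le_pow_left_iff two_ne_zero).1 ((key _ hA.compl).trans ?_)
    calc _ ≤ 1 * δ ^ 2 := mul_le_mul' prob_le_one h2
      _ = _ := one_mul _

theorem lintegral_mul_le_one
    [IsProbabilityMeasure (ρ.withDensity fun x => F x ^ 2)]
    [IsProbabilityMeasure (ρ.withDensity fun x => G x ^ 2)]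
    (hF : AEMeasurable F ρ) (hG : AEMeasurable G ρ) : ∫⁻ x, F x * G x ∂ρ ≤ 1 := by
  have h1 : ∫⁻ x, F x ^ 2 ∂ρ = 1 := by
    simpa using (measure_univ (μ := ρ.withDensity fun x => F x ^ 2))
  have h2 : ∫⁻ x, G x ^ 2 ∂ρ = 1 := by
    simpa using (measure_univ (μ := ρ.withDensity fun x => G x ^ 2))
  have := sq_lintegral_mul_le hF hG
  rw [h1, h2, mul_one] at this
  exact (pow_le_one_iff two_ne_zero).1 this

/-- A measure lying below both `μ` and `ν` has total mass at most `2ε` for every `ε`, hence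
vanishes; no separating set has to be assembled from the approximate ones. -/
theorem mutuallySingular_of_forall_exists_le {μ ν : Measure α} [IsFiniteMeasure μ]
    (h : ∀ ε : ℝ≥0∞, 0 < ε → ∃ A, MeasurableSet A ∧ μ A ≤ ε ∧ ν Aᶜ ≤ ε) : μ ⟂ₘ ν := by
  refine Measure.mutuallySingular_of_disjoint fun ξ hμ hν => ?_
  have : ξ Set.univ = 0 := by
    refine le_antisymm (ENNReal.le_of_forall_pos_le_add fun ε hε _ => ?_) bot_le
    obtain ⟨A, hA, h1, h2⟩ := h (ε / 2) (by simpa using hε.ne')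
    rw [← measure_add_measure_compl hA, zero_add, ← ENNReal.add_halves ε]
    exact add_le_add ((hμ A).trans h1) ((hν _).trans h2)
  rw [Measure.measure_univ_eq_zero.1 this]
  exact bot_le

theorem mutuallySingular_of_lintegral_mul_eq_zero (hF : Measurable F) (hG : Measurable G)
    (h : ∫⁻ x, F x * G x ∂ρ = 0) :
    ρ.withDensity (fun x => F x ^ 2) ⟂ₘ ρ.withDensity (fun x => G x ^ 2) := by
  obtain ⟨A, hA, h1, h2⟩ := exists_measurableSet_withDensity_sq_le (ρ := ρ) hF hG
  rw [h] at h1 h2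
  exact ⟨A, hA, le_antisymm h1 bot_le, le_antisymm h2 bot_le⟩

theorem MeasureTheory.Measure.MutuallySingular.of_map {β : Type*} [MeasurableSpace β] {g : α → β}
    (hg : Measurable g) {μ ν : Measure α} (h : μ.map g ⟂ₘ ν.map g) : μ ⟂ₘ ν := by
  obtain ⟨A, hA, h1, h2⟩ := h
  rw [Measure.map_apply hg hA] at h1
  rw [Measure.map_apply hg hA.compl] at h2
  exact ⟨g ⁻¹' A, hg hA, h1, h2⟩

end Affinity

/-! ### Densities of finite products -/

section ProductDensity

variable {ι : Type*} [Fintype ι]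

theorem lintegral_fin_nat_prod_eq_prod {n : ℕ} {E : Fin n → Type*}
    {mE : ∀ i, MeasurableSpace (E i)} {μ : (i : Fin n) → Measure (E i)} [∀ i, SigmaFinite (μ i)]
    {f : (i : Fin n) → E i → ℝ≥0∞} (hf : ∀ i, Measurable (f i)) :
    ∫⁻ x : (i : Fin n) → E i, ∏ i, f i (x i) ∂(Measure.pi μ) = ∏ i, ∫⁻ x, f i x ∂(μ i) := by
  induction n with
  | zero => simp
  | succ n n_ih =>
      calc
        _ = ∫⁻ x : E 0 × ((i : Fin n) → E (Fin.succ i)),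
            f 0 x.1 * ∏ i : Fin n, f (Fin.succ i) (x.2 i)
            ∂((μ 0).prod (Measure.pi (fun i ↦ μ i.succ))) := by
          rw [((measurePreserving_piFinSuccAbove μ 0).symm).lintegral_map_equiv]
          refine lintegral_congr fun x => ?_
          rw [Fin.prod_univ_succ]
          rfl
        _ = (∫⁻ x, f 0 x ∂μ 0)
            * ∏ i : Fin n, ∫⁻ (x : E (Fin.succ i)), f (Fin.succ i) x ∂(μ i.succ) := by
          rw [← n_ih fun i => hf _]
          refine lintegral_prod_mul (μ := μ 0) (ν := Measure.pi fun i => μ i.succ)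
            (g := fun x => ∏ i : Fin n, f i.succ (x i)) (hf 0).aemeasurable
            (Measurable.aemeasurable ?_)
          exact Finset.measurable_prod _ fun i _ => (hf _).comp (measurable_pi_apply i)
        _ = ∏ i, ∫⁻ x, f i x ∂(μ i) := by rw [Fin.prod_univ_succ]

theorem lintegral_fintype_prod_eq_prod {E : ι → Type*}
    {mE : ∀ i, MeasurableSpace (E i)} {μ : (i : ι) → Measure (E i)} [∀ i, SigmaFinite (μ i)]
    {f : (i : ι) → E i → ℝ≥0∞} (hf : ∀ i, Measurable (f i)) :
    ∫⁻ x : (i : ι) → E i, ∏ i, f i (x i) ∂(Measure.pi μ) = ∏ i, ∫⁻ x, f i x ∂(μ i) := by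
  let e := (Fintype.equivFin ι).symm
  rw [(measurePreserving_piCongrLeft _ e).lintegral_map_equiv]
  simp_rw [← e.prod_comp, MeasurableEquiv.coe_piCongrLeft, Equiv.piCongrLeft_apply_apply]
  exact lintegral_fin_nat_prod_eq_prod fun i => hf _

theorem pi_withDensity_eq {E : ι → Type*}
    {mE : ∀ i, MeasurableSpace (E i)} {μ : (i : ι) → Measure (E i)} [∀ i, SigmaFinite (μ i)]
    {f : (i : ι) → E i → ℝ≥0∞} (hf : ∀ i, Measurable (f i))
    [∀ i, SigmaFinite ((μ i).withDensity (f i))] :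
    Measure.pi (fun i => (μ i).withDensity (f i)) =
      (Measure.pi μ).withDensity (fun x => ∏ i, f i (x i)) := by
  refine Measure.pi_eq fun s hs => ?_
  rw [withDensity_apply _ (MeasurableSet.univ_pi hs), ← lintegral_indicator (MeasurableSet.univ_pi hs)]
  have : ∀ x : (i : ι) → E i, (Set.univ.pi s).indicator (fun x => ∏ i, f i (x i)) x =
      ∏ i, (s i).indicator (f i) (x i) := fun x => by
    classical
    by_cases hx : x ∈ Set.univ.pi s
    · rw [Set.indicator_of_mem hx]
      exact Finset.prod_congr rfl fun i _ => (Set.indicator_of_mem (hx i trivial) _).symm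
    · rw [Set.indicator_of_notMem hx]
      obtain ⟨i, hi⟩ : ∃ i, x i ∉ s i := by simpa [Set.mem_pi] using hx
      exact (Finset.prod_eq_zero (Finset.mem_univ i) (Set.indicator_of_notMem hi _)).symm
  simp_rw [this]
  rw [lintegral_fintype_prod_eq_prod fun i => (hf i).indicator (hs i)]
  exact Finset.prod_congr rfl fun i _ => by
    rw [lintegral_indicator (hs i), withDensity_apply _ (hs i)]

end ProductDensity

/-! ### Kakutani's dichotomy -/

section Kakutani

variable {ι α : Type*} [MeasurableSpace α] {ρ : Measure α} [SigmaFinite ρ] {F G : ι → α → ℝ≥0∞}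

/-- **Kakutani's dichotomy**, singular side: product measures with densities `F i ^ 2` and
`G i ^ 2` are mutually singular if and only if the partial products of their Hellinger affinities
are arbitrarily small. -/
theorem infinitePi_mutuallySingular_iff (hF : ∀ i, Measurable (F i)) (hG : ∀ i, Measurable (G i))
    (μ ν : ι → Measure α) [∀ i, IsProbabilityMeasure (μ i)] [∀ i, IsProbabilityMeasure (ν i)]
    (hμ : ∀ i, μ i = ρ.withDensity fun x => F i x ^ 2)
    (hν : ∀ i, ν i = ρ.withDensity fun x => G i x ^ 2) :
    Measure.infinitePi μ ⟂ₘ Measure.infinitePi ν ↔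
      ∀ ε : ℝ≥0∞, 0 < ε → ∃ I : Finset ι, ∏ i ∈ I, ∫⁻ x, F i x * G i x ∂ρ ≤ ε := by
  let FI (I : Finset ι) (x : I → α) : ℝ≥0∞ := ∏ i : I, F i (x i)
  let GI (I : Finset ι) (x : I → α) : ℝ≥0∞ := ∏ i : I, G i (x i)
  have hFI : ∀ I, Measurable (FI I) := fun I =>
    Finset.measurable_prod _ fun i _ => (hF _).comp (measurable_pi_apply i)
  have hGI : ∀ I, Measurable (GI I) := fun I =>
    Finset.measurable_prod _ fun i _ => (hG _).comp (measurable_pi_apply i)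
  have hμI : ∀ I : Finset ι, (Measure.infinitePi μ).map I.restrict =
      (Measure.pi fun _ : I => ρ).withDensity fun x => FI I x ^ 2 := fun I => by
    have : ∀ i : I, IsProbabilityMeasure (ρ.withDensity fun x => F i x ^ 2) := fun i => by
      rw [← hμ]; infer_instance
    rw [Measure.infinitePi_map_restrict]
    simp_rw [hμ, FI, ← Finset.prod_pow]
    exact pi_withDensity_eq (f := fun (i : I) x => F i x ^ 2) fun i => (hF i).pow_const 2
  have hνI : ∀ I : Finset ι, (Measure.infinitePi ν).map I.restrict =
      (Measure.pi fun _ : I => ρ).withDensity fun x => GI I x ^ 2 := fun I => by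
    have : ∀ i : I, IsProbabilityMeasure (ρ.withDensity fun x => G i x ^ 2) := fun i => by
      rw [← hν]; infer_instance
    rw [Measure.infinitePi_map_restrict]
    simp_rw [hν, GI, ← Finset.prod_pow]
    exact pi_withDensity_eq (f := fun (i : I) x => G i x ^ 2) fun i => (hG i).pow_const 2
  have hH : ∀ I : Finset ι, ∏ i ∈ I, ∫⁻ x, F i x * G i x ∂ρ =
      ∫⁻ x, FI I x * GI I x ∂(Measure.pi fun _ : I => ρ) := fun I => by
    simp_rw [FI, GI, ← Finset.prod_mul_distrib]
    rw [lintegral_fintype_prod_eq_prod (f := fun (i : I) x => F i x * G i x)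
      fun i => (hF i).mul (hG i)]
    exact (Finset.prod_coe_sort I fun i => ∫⁻ x, F i x * G i x ∂ρ).symm
  have hr : ∀ I : Finset ι, Measurable (I.restrict : (ι → α) → (I → α)) :=
    fun I => Finset.measurable_restrict I
  constructor
  · rintro ⟨A, hA, h1, h2⟩ ε hε
    rcases eq_or_ne ε ∞ with rfl | hε'
    · exact ⟨∅, le_top⟩
    have hε0 : 0 < ε.toReal := ENNReal.toReal_pos hε.ne' hε'
    -- A separating set is approximated, for both measures at once, by a cylinder. The error `(ε /
    -- 2) ^ 2` is chosen so that the affinity bound `2δ` with `δ = ε / 2` comes out as `ε`.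
    obtain ⟨C, hC, hAC⟩ := (Measure.MeasureDense.of_generateFrom_isSetAlgebra_finite
      (μ := Measure.infinitePi μ + Measure.infinitePi ν)
      isSetAlgebra_measurableCylinders generateFrom_measurableCylinders.symm).approx A hA
      (measure_ne_top _ _) ((ε.toReal / 2) ^ 2) (by positivity)
    obtain ⟨I, S, hS, rfl⟩ := (mem_measurableCylinders _).1 hC
    refine ⟨I, ?_⟩
    have hδ : ENNReal.ofReal ((ε.toReal / 2) ^ 2) = (ε / 2) ^ 2 := by
      rw [ENNReal.ofReal_pow (by positivity), ENNReal.ofReal_div_of_pos two_pos,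
        ENNReal.ofReal_toReal hε', ENNReal.ofReal_ofNat]
    rw [hδ] at hAC
    have : IsProbabilityMeasure ((Measure.pi fun _ : I => ρ).withDensity fun x => FI I x ^ 2) := by
      rw [← hμI]; exact Measure.isProbabilityMeasure_map (hr I).aemeasurable
    have : IsProbabilityMeasure ((Measure.pi fun _ : I => ρ).withDensity fun x => GI I x ^ 2) := by
      rw [← hνI]; exact Measure.isProbabilityMeasure_map (hr I).aemeasurable
    have hc : 2 * (ε / 2) = ε := ENNReal.mul_div_cancel two_ne_zero ENNReal.ofNat_ne_top
    rw [hH, ← hc]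
    refine lintegral_mul_le_of_withDensity_sq_le (hFI I) (hGI I) hS ?_ ?_
    · rw [← hμI, Measure.map_apply (hr I) hS]
      calc _ ≤ Measure.infinitePi μ (A ∪ symmDiff A (cylinder I S)) := by
            refine measure_mono fun x hx => ?_
            by_cases h : x ∈ A
            · exact Or.inl h
            · exact Or.inr (Or.inr ⟨hx, h⟩)
        _ ≤ Measure.infinitePi μ A + Measure.infinitePi μ (symmDiff A (cylinder I S)) :=
            measure_union_le _ _
        _ ≤ _ := by
            rw [h1, zero_add]
            exact (Measure.le_add_right le_rfl _).trans hAC.le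
    · rw [← hνI, Measure.map_apply (hr I) hS.compl]
      calc _ ≤ Measure.infinitePi ν (Aᶜ ∪ symmDiff A (cylinder I S)) := by
            refine measure_mono fun x hx => ?_
            by_cases h : x ∈ A
            · exact Or.inr (Or.inl ⟨h, hx⟩)
            · exact Or.inl h
        _ ≤ Measure.infinitePi ν Aᶜ + Measure.infinitePi ν (symmDiff A (cylinder I S)) :=
            measure_union_le _ _
        _ ≤ _ := by
            rw [h2, zero_add]
            exact (Measure.le_add_left le_rfl _).trans hAC.le
  -- The finite-dimensional set `{FI ≤ GI}` almost separates the two marginals on `I`; its cylinder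
  -- almost separates the infinite products.
  · refine fun h => mutuallySingular_of_forall_exists_le fun ε hε => ?_
    obtain ⟨I, hI⟩ := h ε hε
    rw [hH] at hI
    obtain ⟨A, hA, h1, h2⟩ := exists_measurableSet_withDensity_sq_le
      (ρ := Measure.pi fun _ : I => ρ) (hFI I) (hGI I)
    rw [← hμI, Measure.map_apply (hr I) hA] at h1
    rw [← hνI, Measure.map_apply (hr I) hA.compl] at h2
    exact ⟨I.restrict ⁻¹' A, hr I hA, h1.trans hI, h2.trans hI⟩

end Kakutani

/-! ### From infinite products to series -/

section Products

variable {ι : Type*} {H : ι → ℝ}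

/-- All but finitely many factors exceed `1 / 2`, and there `-log H ≤ H⁻¹ - 1 ≤ 2 (1 - H)`; so the
logarithms are summable and the exponential of their sum bounds every partial product. -/
theorem exists_pos_le_prod_of_summable_one_sub (h0 : ∀ i, 0 < H i) (h1 : ∀ i, H i ≤ 1)
    (hs : Summable fun i => 1 - H i) : ∃ c, 0 < c ∧ ∀ I : Finset ι, c ≤ ∏ i ∈ I, H i := by
  have hlog : ∀ i, 0 ≤ -Real.log (H i) := fun i => by
    have := Real.log_nonpos (h0 i).le (h1 i)
    linarith
  have hev : ∀ᶠ i in cofinite, 1 - H i < 1 / 2 :=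
    hs.tendsto_cofinite_zero.eventually (gt_mem_nhds (by norm_num))
  have hsum : Summable fun i => -Real.log (H i) := by
    refine Summable.of_norm_bounded_eventually (hs.mul_left 2) ?_
    filter_upwards [hev] with i hi
    rw [Real.norm_of_nonneg (hlog i), ← Real.log_inv]
    have hh : 1 / 2 < H i := by linarith
    refine (Real.log_le_sub_one_of_pos (inv_pos.2 (h0 i))).trans ?_
    rw [← sub_nonneg]
    have : 2 * (1 - H i) - ((H i)⁻¹ - 1) = (1 - H i) * (2 * H i - 1) / H i := by
      field_simp [(h0 i).ne']
    rw [this]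
    exact div_nonneg (mul_nonneg (sub_nonneg.2 (h1 i)) (by linarith)) (h0 i).le
  refine ⟨Real.exp (-∑' i, -Real.log (H i)), Real.exp_pos _, fun I => ?_⟩
  have := hsum.sum_le_tsum I fun i _ => hlog i
  calc _ ≤ Real.exp (∑ i ∈ I, Real.log (H i)) := by
        rw [Finset.sum_neg_distrib] at this
        exact Real.exp_le_exp.2 (by linarith)
    _ = _ := by
        rw [Real.exp_sum]
        exact Finset.prod_congr rfl fun i _ => Real.exp_log (h0 i)

theorem summable_one_sub_of_le_prod (h1 : ∀ i, H i ≤ 1) {c : ℝ} (hc : 0 < c) (h0 : ∀ i, 0 < H i)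
    (h : ∀ I : Finset ι, c ≤ ∏ i ∈ I, H i) : Summable fun i => 1 - H i := by
  refine summable_of_sum_le (c := -Real.log c) (fun i => sub_nonneg.2 (h1 i)) fun I => ?_
  have h2 : Real.log c ≤ ∑ i ∈ I, Real.log (H i) := by
    rw [← Real.log_prod fun i _ => (h0 i).ne']
    exact Real.log_le_log hc (h I)
  have h3 : ∑ i ∈ I, Real.log (H i) ≤ ∑ i ∈ I, (H i - 1) :=
    Finset.sum_le_sum fun i _ => Real.log_le_sub_one_of_pos (h0 i)
  have h4 : ∑ i ∈ I, (1 - H i) = -∑ i ∈ I, (H i - 1) := by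
    rw [← Finset.sum_neg_distrib]
    exact Finset.sum_congr rfl fun i _ => by ring
  linarith

variable {α : Type*} [MeasurableSpace α] {ρ : Measure α} [SigmaFinite ρ] {F G : ι → α → ℝ}

theorem not_infinitePi_mutuallySingular_iff
    (hF : ∀ i, AEMeasurable (F i) ρ) (hG : ∀ i, AEMeasurable (G i) ρ)
    (hF0 : ∀ i x, 0 ≤ F i x) (hG0 : ∀ i x, 0 ≤ G i x)
    (μ ν : ι → Measure α) [∀ i, IsProbabilityMeasure (μ i)] [∀ i, IsProbabilityMeasure (ν i)]
    (hμ : ∀ i, μ i = ρ.withDensity fun x => ENNReal.ofReal (F i x ^ 2))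
    (hν : ∀ i, ν i = ρ.withDensity fun x => ENNReal.ofReal (G i x ^ 2)) :
    (¬ Measure.infinitePi μ ⟂ₘ Measure.infinitePi ν ↔
      (∀ i, ¬ μ i ⟂ₘ ν i) ∧ Summable fun i => 1 - ∫ x, F i x * G i x ∂ρ) := by
  have hF' : ∀ i, AEMeasurable (fun x => ENNReal.ofReal (F i x)) ρ := fun i => (hF i).ennreal_ofReal
  have hG' : ∀ i, AEMeasurable (fun x => ENNReal.ofReal (G i x)) ρ := fun i => (hG i).ennreal_ofReal
  -- The square roots of the densities are only a.e. measurable, so measurable representatives are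
  -- substituted before Kakutani's criterion is applied.
  have hμ' : ∀ i, μ i = ρ.withDensity fun x => (hF' i).mk _ x ^ 2 := fun i => by
    rw [hμ]
    refine withDensity_congr_ae ?_
    filter_upwards [(hF' i).ae_eq_mk] with x hx
    rw [← hx, ENNReal.ofReal_pow (hF0 i x)]
  have hν' : ∀ i, ν i = ρ.withDensity fun x => (hG' i).mk _ x ^ 2 := fun i => by
    rw [hν]
    refine withDensity_congr_ae ?_
    filter_upwards [(hG' i).ae_eq_mk] with x hx
    rw [← hx, ENNReal.ofReal_pow (hG0 i x)]
  have hle : ∀ i, ∫⁻ x, (hF' i).mk _ x * (hG' i).mk _ x ∂ρ ≤ 1 := fun i => by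
    have : IsProbabilityMeasure (ρ.withDensity fun x => (hF' i).mk _ x ^ 2) := by
      rw [← hμ']; infer_instance
    have : IsProbabilityMeasure (ρ.withDensity fun x => (hG' i).mk _ x ^ 2) := by
      rw [← hν']; infer_instance
    exact lintegral_mul_le_one (hF' i).measurable_mk.aemeasurable (hG' i).measurable_mk.aemeasurable
  have hlin : ∀ i, ∫⁻ x, (hF' i).mk _ x * (hG' i).mk _ x ∂ρ =
      ∫⁻ x, ENNReal.ofReal (F i x * G i x) ∂ρ := fun i => by
    refine lintegral_congr_ae ?_
    filter_upwards [(hF' i).ae_eq_mk, (hG' i).ae_eq_mk] with x hx hy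
    rw [← hx, ← hy, ENNReal.ofReal_mul (hF0 i x)]
  have hint : ∀ i, ∫ x, F i x * G i x ∂ρ =
      (∫⁻ x, (hF' i).mk _ x * (hG' i).mk _ x ∂ρ).toReal := fun i => by
    rw [hlin, integral_eq_lintegral_of_nonneg_ae
      (Eventually.of_forall fun x => mul_nonneg (hF0 i x) (hG0 i x))
      ((hF i).mul (hG i)).aestronglyMeasurable]
  have hHH : ∀ i, ∫⁻ x, (hF' i).mk _ x * (hG' i).mk _ x ∂ρ =
      ENNReal.ofReal (∫ x, F i x * G i x ∂ρ) := fun i => by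
    rw [hint, ENNReal.ofReal_toReal ((hle i).trans_lt ENNReal.one_lt_top).ne]
  have hone : ∀ i, ∫ x, F i x * G i x ∂ρ ≤ 1 := fun i => by
    rw [hint]; exact ENNReal.toReal_mono ENNReal.one_ne_top (hle i)
  have h0 : ∀ i, 0 ≤ ∫ x, F i x * G i x ∂ρ := fun i => by
    rw [hint]; exact ENNReal.toReal_nonneg
  rw [infinitePi_mutuallySingular_iff (fun i => (hF' i).measurable_mk)
    (fun i => (hG' i).measurable_mk) μ ν hμ' hν']
  simp_rw [hHH, ← ENNReal.ofReal_prod_of_nonneg fun i _ => h0 i]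
  push Not
  constructor
  · rintro ⟨ε, hε, h⟩
    have hε' : ε ≠ ∞ := (h ∅).ne_top
    have hε0 : 0 < ε.toReal := ENNReal.toReal_pos hε.ne' hε'
    have hprod : ∀ I : Finset ι, ε.toReal ≤ ∏ i ∈ I, ∫ x, F i x * G i x ∂ρ := fun I =>
      (ENNReal.lt_ofReal_iff_toReal_lt hε').1 (h I) |>.le
    have hpos : ∀ i, 0 < ∫ x, F i x * G i x ∂ρ := fun i =>
      hε0.trans_le (by simpa using hprod {i})
    refine ⟨fun i hi => ?_, summable_one_sub_of_le_prod hone hε0 hpos hprod⟩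
    -- Singular marginals would have affinity zero, by Cauchy–Schwarz on the separating set and on
    -- its complement.
    obtain ⟨A, hA, h1, h2⟩ := hi
    have : ∫⁻ x, (hF' i).mk _ x * (hG' i).mk _ x ∂ρ = 0 := by
      rw [← lintegral_add_compl _ hA, add_eq_zero]
      have key : ∀ B, MeasurableSet B →
          (∫⁻ x in B, (hF' i).mk _ x * (hG' i).mk _ x ∂ρ) ^ 2 ≤ μ i B * ν i B := fun B hB => by
        rw [hμ', hν', withDensity_apply _ hB, withDensity_apply _ hB]
        exact sq_lintegral_mul_le (hF' i).measurable_mk.aemeasurable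
          (hG' i).measurable_mk.aemeasurable
      constructor
      · simpa [h1] using key A hA
      · simpa [h2] using key Aᶜ hA.compl
    rw [hHH, ENNReal.ofReal_eq_zero] at this
    exact absurd this (hpos i).not_ge
  · rintro ⟨hns, hs⟩
    have hpos : ∀ i, 0 < ∫ x, F i x * G i x ∂ρ := fun i => by
      refine (h0 i).lt_of_ne fun h => hns i ?_
      rw [hμ', hν']
      refine mutuallySingular_of_lintegral_mul_eq_zero (hF' i).measurable_mk
        (hG' i).measurable_mk ?_
      rw [hHH, ← h, ENNReal.ofReal_zero]
    obtain ⟨c, hc, h⟩ := exists_pos_le_prod_of_summable_one_sub hpos hone hs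
    -- Halving `c` makes the lower bound strict.
    exact ⟨ENNReal.ofReal (c / 2), ENNReal.ofReal_pos.2 (by positivity), fun I =>
      (ENNReal.ofReal_lt_ofReal_iff (hc.trans_le (h I))).2 (by linarith [h I])⟩

end Products

/-! ### Product measures on the sequence space and invariance under the shift -/

section SequenceSpace

variable {r : ℝ≥0∞} [Fact (1 ≤ r)]

theorem RealEll.separableSpace (hr : r ≠ ∞) : TopologicalSpace.SeparableSpace (RealEll r) := by
  have hsep : TopologicalSpace.IsSeparable
      (Submodule.span ℝ (Set.range fun n : ℕ => (lp.single r n (1 : ℝ) : RealEll r)) :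
        Set (RealEll r)) :=
    (Set.countable_range _).isSeparable.span
  rw [← TopologicalSpace.isSeparable_univ_iff]
  refine hsep.closure.mono fun x _ => ?_
  refine mem_closure_of_tendsto (lp.hasSum_single hr x) (Eventually.of_forall fun I => ?_)
  refine Submodule.sum_mem _ fun n _ => ?_
  have : lp.single r n (x n) = x n • (lp.single r n (1 : ℝ) : RealEll r) := by
    rw [← lp.single_smul, smul_eq_mul, mul_one]
  rw [this]
  exact Submodule.smul_mem _ _ (Submodule.subset_span ⟨n, rfl⟩)

theorem RealEll.measurable_apply (n : ℕ) : Measurable fun x : RealEll r => x n := by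
  have hr : r ≠ 0 := (zero_lt_one.trans_le (Fact.out : 1 ≤ r)).ne'
  refine Continuous.measurable (LipschitzWith.continuous (K := 1) ?_)
  refine LipschitzWith.of_dist_le_mul fun x y => ?_
  rw [dist_eq_norm, dist_eq_norm, NNReal.coe_one, one_mul]
  exact lp.norm_apply_le_norm hr (x - y) n

/-- Lusin–Souslin: for finite `r` the space is Polish, and an injective measurable map out of it is
a measurable embedding. This is what allows singularity to be tested on `ℝ^ℕ`. -/
theorem RealEll.measurableEmbedding_coe (hr : r ≠ ∞) :
    MeasurableEmbedding fun (x : RealEll r) (n : ℕ) => x n := by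
  have := RealEll.separableSpace hr
  have : SecondCountableTopology (RealEll r) := UniformSpace.secondCountable_of_separable _
  have : PolishSpace (RealEll r) := inferInstance
  exact (measurable_pi_lambda _ RealEll.measurable_apply).measurableEmbedding
    fun x y h => lp.ext h

variable {μ ν : ℕ → Measure ℝ} [∀ n, IsProbabilityMeasure (μ n)] [∀ n, IsProbabilityMeasure (ν n)]
  {m m' : Measure (RealEll r)}

theorem IsProductMeasure.mutuallySingular_iff (hr : r ≠ ∞) (h : IsProductMeasure m μ)
    (h' : IsProductMeasure m' ν) :
    m ⟂ₘ m' ↔ Measure.infinitePi μ ⟂ₘ Measure.infinitePi ν := by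
  rw [← h, ← h']
  exact ⟨fun hs => (RealEll.measurableEmbedding_coe hr).mutuallySingular_map hs,
    fun hs => hs.of_map (RealEll.measurableEmbedding_coe hr).measurable⟩

theorem IsProductMeasure.map_apply (h : IsProductMeasure m μ) (n : ℕ) :
    m.map (fun x => x n) = μ n := by
  rw [← Measure.infinitePi_map_eval μ n, ← h]
  exact (Measure.map_map (f := fun (x : RealEll r) (k : ℕ) => x k) (measurable_pi_apply n)
    (measurable_pi_lambda _ RealEll.measurable_apply)).symm

/-- Both sides are the law of the coordinate `n` of `B_w x`, which is `w (n + 1) * x (n + 1)` and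
has the law of `x n` by invariance. -/
theorem IsProductMeasure.map_mul_succ {w : ℕ → ℝ} {hw : IsPositiveWeight w}
    (h : IsProductMeasure m μ) (hinv : MeasurePreserving (backwardShift r w hw) m m) (n : ℕ) :
    (μ (n + 1)).map (fun t => w (n + 1) * t) = μ n := by
  rw [← h.map_apply (n + 1), ← h.map_apply n, Measure.map_map (measurable_const_mul _)
    (RealEll.measurable_apply _)]
  conv_rhs => rw [← hinv.map_eq]
  rw [Measure.map_map (RealEll.measurable_apply _) hinv.measurable]
  rfl

theorem IsProductMeasure.map_prod_mul {w : ℕ → ℝ} {hw : IsPositiveWeight w}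
    (h : IsProductMeasure m μ) (hinv : MeasurePreserving (backwardShift r w hw) m m) (n : ℕ) :
    (μ n).map (fun t => (∏ i ∈ Finset.Icc 1 n, w i) * t) = μ 0 := by
  induction n with
  | zero => simp
  | succ n ih =>
    rw [← ih, ← h.map_mul_succ hinv n, Measure.map_map (measurable_const_mul _)
      (measurable_const_mul _)]
    congr 1
    ext t
    rw [Finset.prod_Icc_succ_top (by omega)]
    simp [mul_assoc]

theorem IsPositiveWeight.prod_pos {w : ℕ → ℝ} (hw : IsPositiveWeight w) (n : ℕ) :
    0 < ∏ i ∈ Finset.Icc 1 n, w i :=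
  Finset.prod_pos fun i hi => hw.pos i (Finset.mem_Icc.1 hi).1

/-- Multiplication by `c` is a measurable equivalence, so it suffices to compare images under it. -/
theorem eq_withDensity_of_map_mul_eq {κ κ₀ : Measure ℝ} {c : ℝ} (hc : 0 < c) {p : ℝ → ℝ≥0∞}
    (hp : AEMeasurable p) (h : κ.map (fun t => c * t) = κ₀) (h₀ : κ₀ = volume.withDensity p) :
    κ = volume.withDensity fun t => ENNReal.ofReal c * p (c * t) := by
  let e : ℝ ≃ᵐ ℝ := MeasurableEquiv.mulLeft₀ c hc.ne'
  have he : ∀ t, e t = c * t := fun t => rfl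
  have hvol : Measure.map e volume = ENNReal.ofReal c⁻¹ • volume := by
    have := Real.map_volume_mul_left hc.ne'
    rw [abs_of_pos (inv_pos.2 hc)] at this
    exact this
  have hcc : ENNReal.ofReal c * ENNReal.ofReal c⁻¹ = 1 := by
    rw [← ENNReal.ofReal_mul hc.le, mul_inv_cancel₀ hc.ne', ENNReal.ofReal_one]
  have hm : Measure.map e κ =
      Measure.map e (volume.withDensity fun t => ENNReal.ofReal c * p (c * t)) := by
    have h1 : Measure.map e κ = κ₀ := h
    rw [h1, h₀]
    ext s hs
    rw [e.map_apply, withDensity_apply _ hs, withDensity_apply _ (e.measurable hs)]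
    have : ∫⁻ t in e ⁻¹' s, ENNReal.ofReal c * p (c * t) =
        ∫⁻ t in s, ENNReal.ofReal c * p t ∂(Measure.map e volume) := by
      rw [e.restrict_map, lintegral_map_equiv]
      rfl
    rw [this, hvol, Measure.restrict_smul, lintegral_smul_measure,
      lintegral_const_mul'' _ hp.restrict, smul_eq_mul, ← mul_assoc, mul_comm (ENNReal.ofReal c⁻¹),
      hcc, one_mul]
  exact e.map_measurableEquiv_injective hm

end SequenceSpace

/-! ### The unitary dilation group on `L²(ℝ)`: isometry, continuity and lower bounds -/

section Dilation

/-- The unitary action of dilations on `L²(ℝ)`, in the logarithmic parameter `s`. -/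
noncomputable def dilate (f : ℝ → ℝ) (s t : ℝ) : ℝ := Real.exp (s / 2) * f (Real.exp s * t)

theorem exp_half_sq (s : ℝ) : Real.exp (s / 2) ^ 2 = Real.exp s := by
  rw [← Real.exp_nat_mul]
  congr 1
  push_cast
  ring

theorem dilate_sq (f : ℝ → ℝ) (s t : ℝ) :
    dilate f s t ^ 2 = Real.exp s * f (Real.exp s * t) ^ 2 := by
  rw [dilate, mul_pow, exp_half_sq]

@[simp] theorem dilate_zero (f : ℝ → ℝ) : dilate f 0 = f := by
  ext t; simp [dilate]

theorem dilate_add (f : ℝ → ℝ) (s h t : ℝ) :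
    dilate f (s + h) t = Real.exp (h / 2) * dilate f s (Real.exp h * t) := by
  rw [dilate, dilate, add_div, Real.exp_add, Real.exp_add]
  ring_nf

theorem lintegral_comp_mul_left_of_pos (g : ℝ → ℝ≥0∞) {c : ℝ} (hc : 0 < c) :
    ENNReal.ofReal c * ∫⁻ t, g (c * t) = ∫⁻ t, g t := by
  let e : ℝ ≃ᵐ ℝ := MeasurableEquiv.mulLeft₀ c hc.ne'
  have h1 : ∫⁻ t, g (c * t) = ∫⁻ t, g t ∂(Measure.map e volume) := by
    rw [lintegral_map_equiv]; rfl
  have hvol : Measure.map e volume = ENNReal.ofReal c⁻¹ • volume := by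
    have := Real.map_volume_mul_left hc.ne'
    rw [abs_of_pos (inv_pos.2 hc)] at this
    exact this
  rw [h1, hvol, lintegral_smul_measure, smul_eq_mul, ← mul_assoc, ← ENNReal.ofReal_mul hc.le,
    mul_inv_cancel₀ hc.ne', ENNReal.ofReal_one, one_mul]

theorem quasiMeasurePreserving_exp_mul (s : ℝ) :
    Measure.QuasiMeasurePreserving (fun t : ℝ => Real.exp s * t) volume volume := by
  refine ⟨measurable_const_mul _, ?_⟩
  have := Real.map_volume_mul_left (Real.exp_pos s).ne'
  have h2 : Measure.map (fun t : ℝ => Real.exp s * t) volume = _ := this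
  rw [h2]
  exact Measure.smul_absolutelyContinuous

theorem integral_exp_mul (g : ℝ → ℝ) (s : ℝ) :
    ∫ t, Real.exp s * g (Real.exp s * t) = ∫ t, g t := by
  rw [integral_const_mul, Measure.integral_comp_mul_left, smul_eq_mul,
    abs_of_pos (inv_pos.2 (Real.exp_pos s)), ← mul_assoc, mul_inv_cancel₀ (Real.exp_pos s).ne',
    one_mul]

/-- Unitarity: the substitution `t ↦ e^h t` removes a common dilation, so affinities depend only on
the quotient of the weight products. -/
theorem integral_dilate_mul_dilate (f g : ℝ → ℝ) (s h : ℝ) :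
    ∫ t, dilate f (s + h) t * dilate g h t = ∫ t, dilate f s t * g t := by
  rw [← integral_exp_mul (fun t => dilate f s t * g t) h]
  refine integral_congr_ae (Eventually.of_forall fun t => ?_)
  simp only
  rw [dilate_add, show dilate g h t = Real.exp (h / 2) * g (Real.exp h * t) from rfl,
    ← exp_half_sq h]
  ring

theorem MeasureTheory.MemLp.dilate {f : ℝ → ℝ} (hf : MemLp f 2) (s : ℝ) : MemLp (dilate f s) 2 := by
  have hm : AEStronglyMeasurable (_root_.dilate f s) volume :=
    (hf.1.comp_quasiMeasurePreserving (quasiMeasurePreserving_exp_mul s)).const_mul _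
  refine (memLp_two_iff_integrable_sq hm).2 ?_
  simp_rw [dilate_sq]
  exact (((integrable_comp_mul_left_iff _ (Real.exp_pos s).ne').2 hf.integrable_sq).const_mul _)

theorem norm_toLp_sub_sq {α : Type*} [MeasurableSpace α] {ρ : Measure α} {f g : α → ℝ}
    (hf : MemLp f 2 ρ) (hg : MemLp g 2 ρ) :
    ‖hf.toLp f - hg.toLp g‖ ^ 2 = ∫ x, (f x - g x) ^ 2 ∂ρ := by
  rw [← MemLp.toLp_sub, ← real_inner_self_eq_norm_sq, L2.inner_def]
  refine integral_congr_ae ?_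
  filter_upwards [(hf.sub hg).coeFn_toLp] with x hx
  rw [hx]
  simp [sq]

/-- The orbit of `f` in `L²(ℝ)` under dilations. -/
noncomputable def dilateLp {f : ℝ → ℝ} (hf : MemLp f 2) (s : ℝ) : Lp ℝ 2 (volume : Measure ℝ) :=
  (hf.dilate s).toLp _

variable {f g : ℝ → ℝ}

theorem norm_dilateLp_sub_sq (hf : MemLp f 2) (s t : ℝ) :
    ‖dilateLp hf s - dilateLp hf t‖ ^ 2 = ∫ x, (dilate f s x - dilate f t x) ^ 2 :=
  norm_toLp_sub_sq _ _

theorem norm_dilateLp_add_sub_add (hf : MemLp f 2) (hg : MemLp g 2) (s t h : ℝ) :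
    ‖dilateLp hf (s + h) - dilateLp hg (t + h)‖ = ‖dilateLp hf s - dilateLp hg t‖ := by
  rw [← sq_eq_sq₀ (norm_nonneg _) (norm_nonneg _), dilateLp, dilateLp, norm_toLp_sub_sq, dilateLp,
    dilateLp, norm_toLp_sub_sq,
    ← integral_exp_mul (fun x => (dilate f s x - dilate g t x) ^ 2) h]
  refine integral_congr_ae (Eventually.of_forall fun x => ?_)
  simp only
  rw [dilate_add, dilate_add, ← exp_half_sq h]
  ring

/-- The bridge between Hellinger affinity and `L²` distance. -/
theorem norm_toLp_sub_sq_of_unit (hf : MemLp f 2 volume) (hg : MemLp g 2 volume)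
    (hf1 : ∫ t, f t ^ 2 = 1) (hg1 : ∫ t, g t ^ 2 = 1) :
    ‖hf.toLp f - hg.toLp g‖ ^ 2 = 2 * (1 - ∫ t, f t * g t) := by
  rw [norm_toLp_sub_sq]
  have h : ∀ t, (f t - g t) ^ 2 = f t ^ 2 + g t ^ 2 - 2 * (f t * g t) := fun t => by ring
  simp_rw [h]
  have hi : Integrable (fun t => f t * g t) volume := MemLp.integrable_mul hf hg
  have hs : Integrable (fun t => f t ^ 2 + g t ^ 2) volume := hf.integrable_sq.add hg.integrable_sq
  rw [integral_sub hs (hi.const_mul 2),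
    integral_add hf.integrable_sq hg.integrable_sq, hf1, hg1, integral_const_mul]
  ring

theorem integral_dilate_sq (f : ℝ → ℝ) (s : ℝ) : ∫ t, dilate f s t ^ 2 = ∫ t, f t ^ 2 := by
  simp_rw [dilate_sq]
  exact integral_exp_mul (fun t => f t ^ 2) s

theorem exists_measure_small_or_large_lt (m : Measure ℝ) [IsFiniteMeasure m] (h0 : m {0} = 0)
    {ε : ℝ≥0∞} (hε : 0 < ε) :
    ∃ R : ℝ, 1 < R ∧ m {t | |t| < R⁻¹} < ε ∧ m {t | R ≤ |t|} < ε := by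
  -- Continuity from above; the shift by `2` keeps the radius `R = n + 2` larger than `1`.
  have h1 : Tendsto (fun n : ℕ => m {t | |t| < ((n : ℝ) + 2)⁻¹}) atTop (𝓝 0) := by
    have hi : ⋂ n : ℕ, {t : ℝ | |t| < ((n : ℝ) + 2)⁻¹} = {0} := by
      ext t
      simp only [Set.mem_iInter, Set.mem_ofPred_eq, Set.mem_singleton_iff]
      constructor
      · intro h
        by_contra ht
        obtain ⟨n, hn⟩ := exists_nat_gt (|t|⁻¹)
        have hn' : |t|⁻¹ < (n : ℝ) + 2 := by linarith
        exact (h n).not_ge (inv_le_of_inv_le₀ (abs_pos.2 ht) hn'.le)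
      · rintro rfl n
        rw [abs_zero]
        positivity
    rw [← h0, ← hi]
    refine tendsto_measure_iInter_atTop
      (fun n => (measurableSet_lt measurable_norm measurable_const).nullMeasurableSet)
      (fun a b hab t ht => ?_) ⟨0, measure_ne_top _ _⟩
    refine lt_of_lt_of_le (b := ((b : ℝ) + 2)⁻¹) ht (inv_anti₀ (by positivity) ?_)
    have : (a : ℝ) ≤ b := by exact_mod_cast hab
    linarith
  have h2 : Tendsto (fun n : ℕ => m {t | (n : ℝ) + 2 ≤ |t|}) atTop (𝓝 0) := by
    have hi : ⋂ n : ℕ, {t : ℝ | (n : ℝ) + 2 ≤ |t|} = ∅ := by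
      ext t
      simp only [Set.mem_iInter, Set.mem_ofPred_eq, Set.mem_empty_iff_false, iff_false, not_forall]
      obtain ⟨n, hn⟩ := exists_nat_gt (|t|)
      exact ⟨n, by linarith⟩
    rw [← measure_empty (μ := m), ← hi]
    refine tendsto_measure_iInter_atTop
      (fun n => (measurableSet_le measurable_const measurable_norm).nullMeasurableSet)
      (fun a b hab t ht => ?_) ⟨0, measure_ne_top _ _⟩
    have : (a : ℝ) ≤ b := by exact_mod_cast hab
    exact le_trans (b := (b : ℝ) + 2) (by linarith) ht
  obtain ⟨n, hn1, hn2⟩ := ((h1.eventually (gt_mem_nhds hε)).and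
    (h2.eventually (gt_mem_nhds hε))).exists
  exact ⟨n + 2, by linarith [n.cast_nonneg (α := ℝ)], hn1, hn2⟩

theorem lintegral_ofReal_sq_eq_one (hf : MemLp f 2) (hf1 : ∫ t, f t ^ 2 = 1) :
    ∫⁻ t, ENNReal.ofReal |f t| ^ 2 = 1 := by
  simp_rw [← ENNReal.ofReal_pow (abs_nonneg _), sq_abs]
  rw [← ofReal_integral_eq_lintegral_ofReal hf.integrable_sq
    (Eventually.of_forall fun t => sq_nonneg _), hf1, ENNReal.ofReal_one]

/-- Dilations by large factors move a unit vector of `L²(ℝ)` far away. -/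
theorem exists_one_le_norm_dilateLp_sub (hf : MemLp f 2) (hf1 : ∫ t, f t ^ 2 = 1) :
    ∃ S : ℝ, 0 < S ∧ ∀ s, S ≤ s → 1 ≤ ‖dilateLp hf s - dilateLp hf 0‖ := by
  let F : ℝ → ℝ≥0∞ := fun t => ENNReal.ofReal |f t|
  have hF : AEMeasurable F volume := hf.1.aemeasurable.norm.ennreal_ofReal
  let m : Measure ℝ := volume.withDensity fun t => F t ^ 2
  have hFt : ∫⁻ t, F t ^ 2 = 1 := lintegral_ofReal_sq_eq_one hf hf1
  have hm : IsFiniteMeasure m := isFiniteMeasure_withDensity (by rw [hFt]; exact ENNReal.one_ne_top)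
  have hmac : m ≪ volume := withDensity_absolutelyContinuous _ _
  -- Most of the mass of `f ^ 2` lies in `1/R ≤ |t| < R`. Once `e^s ≥ R ^ 2`, hence the choice `S =
  -- 2 log R`, every `t` with `|t| ≥ 1/R` satisfies `|e^s t| ≥ R`. So `f` is small in `L²` on `|t| <
  -- 1/R` and its dilate is small on the complement.
  obtain ⟨R, hR1, hsm, hla⟩ := exists_measure_small_or_large_lt m (hmac (by simp))
    (ε := ENNReal.ofReal ((1 / 4) ^ 2)) (by simp)
  refine ⟨2 * Real.log R, by have := Real.log_pos hR1; positivity, fun s hs => ?_⟩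
  have hRs : R ^ 2 ≤ Real.exp s := by
    rw [← Real.exp_log (by linarith : 0 < R), ← Real.exp_nat_mul]
    exact Real.exp_le_exp.2 (by push_cast; exact hs)
  let D : ℝ → ℝ≥0∞ := fun t => ENNReal.ofReal |dilate f s t|
  have hD : AEMeasurable D volume := (hf.dilate s).1.aemeasurable.norm.ennreal_ofReal
  have hDt : ∫⁻ t, D t ^ 2 = 1 :=
    lintegral_ofReal_sq_eq_one (hf.dilate s) ((integral_dilate_sq f s).trans hf1)
  let A : Set ℝ := {t | |t| < R⁻¹}
  have hA : MeasurableSet A := measurableSet_lt measurable_norm measurable_const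
  have hB : MeasurableSet {t : ℝ | R ≤ |t|} := measurableSet_le measurable_const measurable_norm
  have hR0 : 0 < R := by linarith
  have hAs : ∫⁻ t in A, F t ^ 2 ≤ ENNReal.ofReal ((1 / 4) ^ 2) := by
    rw [← withDensity_apply _ hA]; exact hsm.le
  have hAl : ∫⁻ t in Aᶜ, D t ^ 2 ≤ ENNReal.ofReal ((1 / 4) ^ 2) := by
    have hDF : ∀ t, D t ^ 2 = ENNReal.ofReal (Real.exp s) * F (Real.exp s * t) ^ 2 := fun t => by
      simp only [D, F]
      rw [← ENNReal.ofReal_pow (abs_nonneg _), sq_abs, dilate_sq, ← ENNReal.ofReal_pow (abs_nonneg _),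
        sq_abs, ENNReal.ofReal_mul (Real.exp_pos s).le]
    calc ∫⁻ t in Aᶜ, D t ^ 2
        ≤ ∫⁻ t, ENNReal.ofReal (Real.exp s) *
          ({t : ℝ | R ≤ |t|}.indicator (fun t => F t ^ 2) (Real.exp s * t)) := by
          rw [← lintegral_indicator hA.compl]
          refine lintegral_mono fun t => ?_
          by_cases ht : t ∈ Aᶜ
          · rw [Set.indicator_of_mem ht, Set.indicator_of_mem, hDF]
            have ht' : R⁻¹ ≤ |t| := not_lt.1 ht
            change R ≤ |Real.exp s * t|
            rw [abs_mul, abs_of_pos (Real.exp_pos s)]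
            calc R = R ^ 2 * R⁻¹ := by field_simp
              _ ≤ _ := by gcongr
          · rw [Set.indicator_of_notMem ht]; exact bot_le
      _ = ∫⁻ t in {t : ℝ | R ≤ |t|}, F t ^ 2 := by
          rw [lintegral_const_mul' _ _ ENNReal.ofReal_ne_top,
            lintegral_comp_mul_left_of_pos _ (Real.exp_pos s), lintegral_indicator hB]
      _ ≤ _ := by rw [← withDensity_apply _ hB]; exact hla.le
  have hle : ∀ B : Set ℝ, (∫⁻ t in B, D t ^ 2) * ∫⁻ t in B, F t ^ 2 ≤ ENNReal.ofReal ((1 / 4) ^ 2) →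
      ∫⁻ t in B, D t * F t ≤ ENNReal.ofReal (1 / 4) := fun B hB => by
    refine (ENNReal.pow_le_pow_left_iff two_ne_zero).1
      ((sq_lintegral_mul_le hD.restrict hF.restrict).trans ?_)
    rw [← ENNReal.ofReal_pow (by norm_num)]
    exact hB
  -- The two pieces contribute at most `1 / 4` each; affinity at most `1 / 2` means squared distance
  -- at least `1`.
  have hDF : ∫⁻ t, D t * F t ≤ ENNReal.ofReal (1 / 2) := by
    rw [← lintegral_add_compl _ hA, show (1 / 2 : ℝ) = 1 / 4 + 1 / 4 by norm_num,
      ENNReal.ofReal_add (by norm_num) (by norm_num)]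
    refine add_le_add (hle _ ?_) (hle _ ?_)
    · exact (mul_le_mul' ((setLIntegral_le_lintegral _ _).trans hDt.le) hAs).trans (one_mul _).le
    · exact (mul_le_mul' hAl ((setLIntegral_le_lintegral _ _).trans hFt.le)).trans (mul_one _).le
  have hint : ∫ t, dilate f s t * f t ≤ 1 / 2 := by
    refine (le_abs_self _).trans ?_
    rw [← Real.norm_eq_abs]
    refine (norm_integral_le_lintegral_norm _).trans ?_
    refine ENNReal.toReal_le_of_le_ofReal (by norm_num) (le_trans (le_of_eq ?_) hDF)
    refine lintegral_congr fun t => ?_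
    rw [norm_mul, ENNReal.ofReal_mul (norm_nonneg _)]
    rfl
  have h2 : ‖dilateLp hf s - dilateLp hf 0‖ ^ 2 = 2 * (1 - ∫ t, dilate f s t * dilate f 0 t) :=
    norm_toLp_sub_sq_of_unit (hf.dilate s) (hf.dilate 0) ((integral_dilate_sq f s).trans hf1)
      ((integral_dilate_sq f 0).trans hf1)
  rw [dilate_zero] at h2
  nlinarith [norm_nonneg (dilateLp hf s - dilateLp hf 0)]

/-- Triangle inequality along the orbit, all steps of which have equal length because dilations are
isometries. -/
theorem norm_dilateLp_nsmul_sub_le (hf : MemLp f 2) (s : ℝ) (n : ℕ) :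
    ‖dilateLp hf (n * s) - dilateLp hf 0‖ ≤ n * ‖dilateLp hf s - dilateLp hf 0‖ := by
  induction n with
  | zero => simp
  | succ n ih =>
    have h1 := norm_sub_le_norm_sub_add_norm_sub (dilateLp hf ((n + 1 : ℕ) * s))
      (dilateLp hf (n * s)) (dilateLp hf 0)
    have h2 : ‖dilateLp hf ((n + 1 : ℕ) * s) - dilateLp hf (n * s)‖ =
        ‖dilateLp hf s - dilateLp hf 0‖ := by
      rw [← norm_dilateLp_add_sub_add hf hf s 0 (n * s)]
      congr 3 <;> push_cast <;> ring
    push_cast at *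
    linarith

theorem norm_dilateLp_sub_eq (hf : MemLp f 2) (s t : ℝ) :
    ‖dilateLp hf s - dilateLp hf t‖ = ‖dilateLp hf |s - t| - dilateLp hf 0‖ := by
  rcases le_total t s with h | h
  · rw [abs_of_nonneg (sub_nonneg.2 h), ← norm_dilateLp_add_sub_add hf hf (s - t) 0 t]
    simp
  · rw [abs_of_nonpos (sub_nonpos.2 h), ← norm_dilateLp_add_sub_add hf hf (-(s - t)) 0 s,
      norm_sub_rev]
    simp

/-- The orbit map of a unit vector under dilations is bounded below, locally linearly. -/
theorem exists_mul_min_le_norm_dilateLp_sub (hf : MemLp f 2) (hf1 : ∫ t, f t ^ 2 = 1) :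
    ∃ c : ℝ, 0 < c ∧ ∀ s t, c * min 1 |s - t| ≤ ‖dilateLp hf s - dilateLp hf t‖ := by
  obtain ⟨S, hS, h⟩ := exists_one_le_norm_dilateLp_sub hf hf1
  refine ⟨(S + 1)⁻¹, by positivity, fun s t => ?_⟩
  rw [norm_dilateLp_sub_eq]
  rcases (abs_nonneg (s - t)).eq_or_lt with h0 | hpos
  · rw [← h0, min_eq_right zero_le_one, mul_zero]
    exact norm_nonneg _
  generalize |s - t| = x at hpos
  -- With `x = |s - t|`, a number `⌈S / x⌉` of steps of size `x` reaches the range where the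
  -- displacement is at least `1`. As this number is below `S / x + 1`, one step has length at least
  -- `x / (S + x)`, which is at least `min 1 x / (S + 1)`.
  have hn1 : S ≤ ⌈S / x⌉₊ * x := by
    rw [← div_le_iff₀ hpos]; exact Nat.le_ceil _
  have hn2 : (⌈S / x⌉₊ : ℝ) < S / x + 1 := Nat.ceil_lt_add_one (by positivity)
  have h1 := (h _ hn1).trans (norm_dilateLp_nsmul_sub_le hf x _)
  have h2 : 1 ≤ (S / x + 1) * ‖dilateLp hf x - dilateLp hf 0‖ :=
    h1.trans (mul_le_mul_of_nonneg_right hn2.le (norm_nonneg _))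
  have h3 : x ≤ (S + x) * ‖dilateLp hf x - dilateLp hf 0‖ := by
    calc x = x * 1 := (mul_one x).symm
      _ ≤ x * ((S / x + 1) * ‖dilateLp hf x - dilateLp hf 0‖) := by gcongr
      _ = _ := by field_simp
  generalize ‖dilateLp hf x - dilateLp hf 0‖ = y at h3
  rw [inv_mul_le_iff₀ (by positivity)]
  rcases le_total x 1 with hx | hx
  · rw [min_eq_right hx]
    nlinarith
  · rw [min_eq_left hx]
    nlinarith

theorem HasCompactSupport.tendsto_integral_dilate_sub_sq {k : ℝ → ℝ} (hk : HasCompactSupport k)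
    (hc : Continuous k) :
    Tendsto (fun s => ∫ t, (dilate k s t - k t) ^ 2) (𝓝 0) (𝓝 0) := by
  obtain ⟨M, hM⟩ := hc.bounded_above_of_compact_support hk
  have hM0 : 0 ≤ M := (norm_nonneg _).trans (hM 0)
  obtain ⟨R, hR0, hR⟩ := hk.isCompact.isBounded.subset_closedBall_lt 0 (0 : ℝ)
  have hsupp : ∀ t, R < |t| → k t = 0 := fun t ht => by
    by_contra h
    have := hR (subset_tsupport k h)
    rw [mem_closedBall_zero_iff, Real.norm_eq_abs] at this
    linarith
  have h0 : (0 : ℝ) = ∫ t, (dilate k 0 t - k t) ^ 2 := by simp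
  nth_rewrite 2 [h0]
  -- For `|s| < 1` both functions vanish outside the ball of radius `e R`, and their difference is
  -- at most `e M + M`.
  refine tendsto_integral_filter_of_dominated_convergence
    ((Metric.closedBall 0 (Real.exp 1 * R)).indicator fun _ => (Real.exp 1 * M + M) ^ 2) ?_ ?_ ?_ ?_
  · refine Eventually.of_forall fun s => Continuous.aestronglyMeasurable ?_
    unfold dilate
    fun_prop
  · have : ∀ᶠ s : ℝ in 𝓝 0, |s| < 1 := by
      have := (continuous_abs (G := ℝ)).tendsto 0
      rw [abs_zero] at this
      exact this.eventually (gt_mem_nhds one_pos)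
    filter_upwards [this] with s hs
    refine Eventually.of_forall fun t => ?_
    rw [abs_lt] at hs
    by_cases ht : t ∈ Metric.closedBall (0 : ℝ) (Real.exp 1 * R)
    · rw [Set.indicator_of_mem ht, norm_pow]
      refine pow_le_pow_left₀ (norm_nonneg _) ((norm_sub_le _ _).trans (add_le_add ?_ (hM t))) 2
      rw [dilate, norm_mul, Real.norm_of_nonneg (Real.exp_pos _).le]
      exact mul_le_mul (Real.exp_le_exp.2 (by linarith)) (hM _) (norm_nonneg _) (Real.exp_pos _).le
    · rw [mem_closedBall_zero_iff, Real.norm_eq_abs, not_le] at ht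
      have h1 : R < |t| := lt_of_le_of_lt
        (le_mul_of_one_le_left hR0.le (Real.one_le_exp zero_le_one)) ht
      have h2 : R < |Real.exp s * t| := by
        rw [abs_mul, abs_of_pos (Real.exp_pos s)]
        calc R = Real.exp (-1) * (Real.exp 1 * R) := by
              rw [← mul_assoc, ← Real.exp_add]; simp
          _ < Real.exp (-1) * |t| := mul_lt_mul_of_pos_left ht (Real.exp_pos _)
          _ ≤ _ := mul_le_mul_of_nonneg_right (Real.exp_le_exp.2 hs.1.le) (abs_nonneg _)
      rw [dilate, hsupp _ h1, hsupp _ h2]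
      simpa using Set.indicator_nonneg (fun _ _ => by positivity) _
  · exact (integrable_indicator_iff Metric.isClosed_closedBall.measurableSet).2
      (integrableOn_const (isCompact_closedBall _ _).measure_ne_top)
  · refine Eventually.of_forall fun t => Continuous.tendsto ?_ 0
    unfold dilate
    fun_prop

/-- An `ε / 3` argument: continuous compactly supported functions are dense in `L²`, and dilations
being isometric makes the approximation error uniform in `s`. -/
theorem tendsto_dilateLp_zero (hf : MemLp f 2) :
    Tendsto (dilateLp hf) (𝓝 0) (𝓝 (dilateLp hf 0)) := by
  rw [Metric.tendsto_nhds]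
  intro ε hε
  obtain ⟨k, hks, hk, hkc, hkL⟩ := hf.exists_hasCompactSupport_eLpNorm_sub_le (by norm_num)
    (ε := ENNReal.ofReal (ε / 3)) (by simpa using hε)
  have hfk : ‖dilateLp hf 0 - dilateLp hkL 0‖ ≤ ε / 3 := by
    rw [dilateLp, dilateLp, ← MemLp.toLp_sub, Lp.norm_toLp]
    refine ENNReal.toReal_le_of_le_ofReal (by positivity) ?_
    simpa using hk
  have hsq : Tendsto (fun s => ‖dilateLp hkL s - dilateLp hkL 0‖) (𝓝 0) (𝓝 0) := by
    have h := (hks.tendsto_integral_dilate_sub_sq hkc).sqrt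
    rw [Real.sqrt_zero] at h
    refine h.congr fun s => ?_
    rw [← Real.sqrt_sq (norm_nonneg (dilateLp hkL s - dilateLp hkL 0)), norm_dilateLp_sub_sq,
      dilate_zero]
  filter_upwards [hsq.eventually (gt_mem_nhds (by positivity : 0 < ε / 3))] with s hs
  rw [dist_eq_norm]
  have h1 : ‖dilateLp hf s - dilateLp hkL s‖ ≤ ε / 3 := by
    have := norm_dilateLp_add_sub_add hf hkL 0 0 s
    rw [zero_add] at this
    rwa [this]
  have h2 : dilateLp hf s - dilateLp hf 0 = (dilateLp hf s - dilateLp hkL s) +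
      (dilateLp hkL s - dilateLp hkL 0) - (dilateLp hf 0 - dilateLp hkL 0) := by abel
  rw [h2]
  have h3 := norm_sub_le ((dilateLp hf s - dilateLp hkL s) +
      (dilateLp hkL s - dilateLp hkL 0)) (dilateLp hf 0 - dilateLp hkL 0)
  have h4 := norm_add_le (dilateLp hf s - dilateLp hkL s) (dilateLp hkL s - dilateLp hkL 0)
  linarith

theorem continuous_dilateLp (hf : MemLp f 2) : Continuous (dilateLp hf) := by
  rw [continuous_iff_continuousAt]
  intro s₀
  rw [ContinuousAt, tendsto_iff_norm_sub_tendsto_zero]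
  have h := tendsto_iff_norm_sub_tendsto_zero.1 (tendsto_dilateLp_zero hf)
  have h2 : Tendsto (fun s : ℝ => s - s₀) (𝓝 s₀) (𝓝 0) := by
    have : Continuous fun s : ℝ => s - s₀ := by fun_prop
    simpa using this.tendsto s₀
  refine (h.comp h2).congr fun s => ?_
  rw [Function.comp_apply, ← norm_dilateLp_add_sub_add hf hf (s - s₀) 0 s₀]
  simp

theorem dilateLp_injective (hf : MemLp f 2) (hf1 : ∫ t, f t ^ 2 = 1) :
    Function.Injective (dilateLp hf) := fun s t hst => by
  obtain ⟨c, hc, h⟩ := exists_mul_min_le_norm_dilateLp_sub hf hf1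
  have := h s t
  rw [hst, sub_self, norm_zero] at this
  by_contra hne
  exact this.not_gt (mul_pos hc (lt_min one_pos (abs_pos.2 (sub_ne_zero.2 hne))))

/-- The lower bound on displacements makes the parameters Cauchy as soon as the orbit points are;
the limit is then identified by continuity of the orbit map. -/
theorem exists_tendsto_of_tendsto_dilateLp (hf : MemLp f 2) (hf1 : ∫ t, f t ^ 2 = 1)
    {s : ℕ → ℝ} {y : Lp ℝ 2 (volume : Measure ℝ)}
    (h : Tendsto (fun n => dilateLp hf (s n)) atTop (𝓝 y)) :
    ∃ b, Tendsto s atTop (𝓝 b) ∧ y = dilateLp hf b := by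
  obtain ⟨c, hc, hlow⟩ := exists_mul_min_le_norm_dilateLp_sub hf hf1
  have hcau : CauchySeq s := by
    rw [Metric.cauchySeq_iff]
    intro ε hε
    obtain ⟨N, hN⟩ := Metric.cauchySeq_iff.1 h.cauchySeq (c * min 1 ε) (by positivity)
    refine ⟨N, fun m hm n hn => ?_⟩
    have h1 := (hlow (s m) (s n)).trans_lt (dist_eq_norm (dilateLp hf (s m)) _ ▸ hN m hm n hn)
    have h2 := lt_of_mul_lt_mul_left h1 hc.le
    rw [Real.dist_eq]
    by_contra hge
    exact h2.not_ge (min_le_min_left 1 (not_lt.1 hge))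
  obtain ⟨b, hb⟩ := cauchySeq_tendsto_of_complete hcau
  exact ⟨b, hb, tendsto_nhds_unique h (((continuous_dilateLp hf).tendsto b).comp hb)⟩

theorem summable_sub_sq_of_summable_dilateLp (hf : MemLp f 2) (hf1 : ∫ t, f t ^ 2 = 1)
    {s : ℕ → ℝ} {y : Lp ℝ 2 (volume : Measure ℝ)}
    (h : Summable fun n => ‖dilateLp hf (s n) - y‖ ^ 2) :
    ∃ b, Tendsto s atTop (𝓝 b) ∧ y = dilateLp hf b ∧ Summable fun n => (s n - b) ^ 2 := by
  have h0 : Tendsto (fun n => dilateLp hf (s n)) atTop (𝓝 y) := by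
    rw [tendsto_iff_norm_sub_tendsto_zero]
    have := h.tendsto_atTop_zero.sqrt
    simpa [Real.sqrt_sq] using this
  obtain ⟨b, hb, rfl⟩ := exists_tendsto_of_tendsto_dilateLp hf hf1 h0
  obtain ⟨c, hc, hlow⟩ := exists_mul_min_le_norm_dilateLp_sub hf hf1
  refine ⟨b, hb, rfl, ?_⟩
  refine Summable.of_norm_bounded_eventually_nat (h.mul_left (c ^ 2)⁻¹) ?_
  have h1 : Tendsto (fun n => |s n - b|) atTop (𝓝 0) := by
    simpa using (hb.sub_const b).abs
  filter_upwards [h1.eventually (gt_mem_nhds one_pos)] with n hn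
  have h2 := hlow (s n) b
  rw [min_eq_right hn.le] at h2
  rw [norm_pow, Real.norm_eq_abs, le_inv_mul_iff₀ (by positivity), ← mul_pow]
  exact pow_le_pow_left₀ (by positivity) h2 2

end Dilation

/-! ### Upper bounds for small dilations, through the generator -/

section Generator

/-- The infinitesimal generator of the group of dilations, applied to `f`. -/
noncomputable def dilationGenerator (f : ℝ → ℝ) (t : ℝ) : ℝ := f t / 2 + t * deriv f t

variable {f : ℝ → ℝ} {S : Set ℝ}

theorem measurable_of_continuousOn_compl_finite (hS : S.Finite) (hf : ContinuousOn f Sᶜ) :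
    Measurable f :=
  measurable_of_measurable_on_compl_finite S hS (continuousOn_iff_continuous_domRestrict.1 hf).measurable

theorem ContDiffOn.hasDerivAt_of_notMem_finite (hS : S.Finite) (hf : ContDiffOn ℝ 1 f Sᶜ) {t : ℝ}
    (ht : t ∉ S) : HasDerivAt f (deriv f t) t :=
  ((hf.differentiableOn one_ne_zero t ht).differentiableAt
    (hS.isClosed.isOpen_compl.mem_nhds ht)).hasDerivAt

theorem measurable_dilationGenerator (hf : Measurable f) : Measurable (dilationGenerator f) :=
  (hf.div_const 2).add (measurable_id.mul (measurable_deriv f))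

theorem MeasureTheory.MemLp.dilationGenerator (hf : MemLp f 2 volume)
    (hf' : MemLp (fun t => t * deriv f t) 2 volume) :
    MemLp (dilationGenerator f) 2 volume := by
  have := (hf.const_mul (1 / 2)).add hf'
  refine this.ae_eq (Eventually.of_forall fun t => ?_)
  simp only [_root_.dilationGenerator, Pi.add_apply]
  ring

theorem hasDerivAt_dilate {s t : ℝ}
    (hf : HasDerivAt f (deriv f (Real.exp s * t)) (Real.exp s * t)) :
    HasDerivAt (fun σ => dilate f σ t) (dilate (dilationGenerator f) s t) s := by
  have h1 : HasDerivAt (fun σ => Real.exp (σ / 2)) (Real.exp (s / 2) * (1 / 2)) s :=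
    ((hasDerivAt_id s).div_const 2).exp
  have h2 : HasDerivAt (fun σ => Real.exp σ * t) (Real.exp s * t) s :=
    (Real.hasDerivAt_exp s).mul_const t
  have h3 := h1.mul (HasDerivAt.comp s hf h2)
  refine h3.congr_deriv ?_
  simp only [dilate, dilationGenerator, Function.comp_apply]
  ring

/-- The fundamental theorem of calculus along `σ ↦ D_σ f(t)`, followed by Cauchy–Schwarz in `σ`.
Continuity is required on the whole path from `t` to `e^s t`, because differentiability is only
known off a finite set. -/
theorem ofReal_sq_dilate_sub_le (hS : S.Finite) (hfS : ∀ t ∉ S, HasDerivAt f (deriv f t) t)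
    (hfm : Measurable f) {s t : ℝ} (hs : 0 ≤ s) (ht : t ≠ 0)
    (hc : ∀ σ ∈ Set.Icc 0 s, ContinuousAt f (Real.exp σ * t)) :
    ENNReal.ofReal ((dilate f s t - f t) ^ 2) ≤
      ENNReal.ofReal s *
        ∫⁻ σ in Set.Ioc 0 s, ENNReal.ofReal (dilate (dilationGenerator f) σ t ^ 2) := by
  rcases hs.eq_or_lt with rfl | hs0
  · simp
  have hgm : Measurable fun σ => dilate (dilationGenerator f) σ t := by
    have := measurable_dilationGenerator hfm
    unfold dilate
    fun_prop
  -- If the right-hand integral is infinite the bound is trivial; otherwise its finiteness supplies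
  -- the integrability needed below.
  by_cases htop : ∫⁻ σ in Set.Ioc 0 s, ENNReal.ofReal (dilate (dilationGenerator f) σ t ^ 2) = ∞
  · rw [htop, ENNReal.mul_top (by simpa using hs0)]
    exact le_top
  have hmem : MemLp (fun σ => dilate (dilationGenerator f) σ t) 2
      (volume.restrict (Set.Ioc 0 s)) := by
    refine (memLp_two_iff_integrable_sq hgm.aestronglyMeasurable).2
      ⟨(hgm.pow_const 2).aestronglyMeasurable, ?_⟩
    rw [hasFiniteIntegral_iff_ofReal (Eventually.of_forall fun _ => sq_nonneg _)]
    exact lt_top_iff_ne_top.2 htop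
  have hint : IntervalIntegrable (fun σ => dilate (dilationGenerator f) σ t) volume 0 s :=
    (intervalIntegrable_iff_integrableOn_Ioc_of_le hs).2 (hmem.integrable one_le_two)
  have hcount : {σ : ℝ | Real.exp σ * t ∈ S}.Countable :=
    (hS.preimage (f := fun σ => Real.exp σ * t) (fun a _ b _ hab =>
      Real.exp_injective (mul_right_cancel₀ ht hab))).countable
  have hftc : ∫ σ in (0 : ℝ)..s, dilate (dilationGenerator f) σ t = dilate f s t - dilate f 0 t := by
    refine integral_eq_of_hasDerivAt_off_countable_of_le (fun σ => dilate f σ t) _ hs hcount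
      (fun σ hσ => ContinuousAt.continuousWithinAt ?_) (fun σ hσ => ?_) hint
    · have h2 : ContinuousAt (fun σ => Real.exp σ * t) σ := by fun_prop
      have h1 : ContinuousAt (fun σ : ℝ => Real.exp (σ / 2)) σ := by fun_prop
      exact h1.mul (ContinuousAt.comp (f := fun σ => Real.exp σ * t) (hc σ hσ) h2)
    · exact hasDerivAt_dilate (hfS _ hσ.2)
  rw [dilate_zero, intervalIntegral.integral_of_le hs] at hftc
  have h1 : ENNReal.ofReal |dilate f s t - f t| ≤
      ∫⁻ σ in Set.Ioc 0 s, ENNReal.ofReal |dilate (dilationGenerator f) σ t| * 1 := by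
    rw [← hftc, ← Real.norm_eq_abs, ofReal_norm]
    refine (enorm_integral_le_lintegral_enorm _).trans (le_of_eq (lintegral_congr fun σ => ?_))
    rw [mul_one, ← Real.norm_eq_abs, ofReal_norm]
  rw [← sq_abs, ENNReal.ofReal_pow (abs_nonneg _)]
  refine (pow_le_pow_left' h1 2).trans ((sq_lintegral_mul_le
    (F := fun σ => ENNReal.ofReal |dilate (dilationGenerator f) σ t|) (G := fun _ => 1)
    (hgm.norm.ennreal_ofReal.aemeasurable) aemeasurable_const).trans ?_)
  simp_rw [← ENNReal.ofReal_pow (abs_nonneg _), sq_abs]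
  rw [mul_comm]
  simp

theorem lintegral_lintegral_dilate_sq {g : ℝ → ℝ} (hg : Measurable g) {s : ℝ} :
    ∫⁻ t, ∫⁻ σ in Set.Ioc 0 s, ENNReal.ofReal (dilate g σ t ^ 2) =
      ENNReal.ofReal s * ∫⁻ t, ENNReal.ofReal (g t ^ 2) := by
  rw [lintegral_lintegral_swap]
  · have : ∀ σ, ∫⁻ t, ENNReal.ofReal (dilate g σ t ^ 2) = ∫⁻ t, ENNReal.ofReal (g t ^ 2) :=
      fun σ => by
        simp_rw [dilate_sq, ENNReal.ofReal_mul (Real.exp_pos σ).le]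
        rw [lintegral_const_mul' _ _ ENNReal.ofReal_ne_top,
          lintegral_comp_mul_left_of_pos (fun t => ENNReal.ofReal (g t ^ 2)) (Real.exp_pos σ)]
    simp_rw [this]
    rw [setLIntegral_const, Real.volume_Ioc, sub_zero, mul_comm]
  · refine Measurable.aemeasurable ?_
    simp only [Function.uncurry_def]
    unfold dilate
    fun_prop

/-- Writing the set through `t / d` treats positive and negative `d` together. -/
theorem volume_div_mem_Ioo {d : ℝ} (hd : d ≠ 0) (a b : ℝ) :
    volume {t : ℝ | t / d ∈ Set.Ioo a b} = ENNReal.ofReal |d| * ENNReal.ofReal (b - a) := by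
  have := Real.volume_preimage_mul_right (inv_ne_zero hd) (Set.Ioo a b)
  rw [inv_inv, Real.volume_Ioo] at this
  exact this

theorem volume_div_mem_Icc {d : ℝ} (hd : d ≠ 0) (a b : ℝ) :
    volume {t : ℝ | t / d ∈ Set.Icc a b} = ENNReal.ofReal |d| * ENNReal.ofReal (b - a) := by
  have := Real.volume_preimage_mul_right (inv_ne_zero hd) (Set.Icc a b)
  rw [inv_inv, Real.volume_Icc] at this
  exact this

/-- The set consists of the `t` whose path to `e^s t` meets `d`. Its measure is `|d| (1 - e^{-s}) ≤
|d| s`, and the integrand is bounded on it, so a possible jump costs only `O(s)`. -/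
theorem exists_setLIntegral_sq_dilate_sub_le {d M : ℝ} (hd : d ≠ 0)
    (hM : ∀ᶠ t in 𝓝 d, |f t| ≤ M) :
    ∃ C : ℝ, 0 ≤ C ∧ ∀ᶠ s in 𝓝[≥] (0 : ℝ),
      ∫⁻ t in {t | t / d ∈ Set.Icc (Real.exp (-s)) 1}, ENNReal.ofReal ((dilate f s t - f t) ^ 2) ≤
        ENNReal.ofReal (C * s) := by
  have hM0 : 0 ≤ M := (abs_nonneg _).trans hM.self_of_nhds
  obtain ⟨ε, hε, hball⟩ := Metric.eventually_nhds_iff.1 hM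
  have hlim : ∀ᶠ s : ℝ in 𝓝 0, |d| * (Real.exp s - 1) < ε ∧ |d| * (1 - Real.exp (-s)) < ε ∧ s < 1 := by
    have h1 : Tendsto (fun s : ℝ => |d| * (Real.exp s - 1)) (𝓝 0) (𝓝 0) := by
      have : Continuous fun s : ℝ => |d| * (Real.exp s - 1) := by fun_prop
      simpa using this.tendsto 0
    have h2 : Tendsto (fun s : ℝ => |d| * (1 - Real.exp (-s))) (𝓝 0) (𝓝 0) := by
      have : Continuous fun s : ℝ => |d| * (1 - Real.exp (-s)) := by fun_prop
      simpa using this.tendsto 0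
    exact (h1.eventually (gt_mem_nhds hε)).and ((h2.eventually (gt_mem_nhds hε)).and
      (gt_mem_nhds one_pos))
  refine ⟨(Real.exp 1 * M + M) ^ 2 * |d|, by positivity, ?_⟩
  filter_upwards [nhdsWithin_le_nhds hlim, self_mem_nhdsWithin] with s ⟨hs1, hs2, hs3⟩ hs0
  have hs0' : 0 ≤ s := hs0
  have hset : MeasurableSet {t : ℝ | t / d ∈ Set.Icc (Real.exp (-s)) 1} :=
    (measurable_id.div_const d) measurableSet_Icc
  have hnear : ∀ r, Real.exp (-s) ≤ r → r ≤ Real.exp s → |f (r * d)| ≤ M := fun r h1 h2 => by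
    apply hball
    rw [Real.dist_eq, show r * d - d = d * (r - 1) by ring, abs_mul]
    rcases le_total 1 r with h | h
    · rw [abs_of_nonneg (sub_nonneg.2 h)]
      exact (mul_le_mul_of_nonneg_left (by linarith) (abs_nonneg d)).trans_lt hs1
    · rw [abs_of_nonpos (sub_nonpos.2 h)]
      exact (mul_le_mul_of_nonneg_left (by linarith) (abs_nonneg d)).trans_lt hs2
  calc _ ≤ ∫⁻ t in {t | t / d ∈ Set.Icc (Real.exp (-s)) 1},
          ENNReal.ofReal ((Real.exp 1 * M + M) ^ 2) := by
        refine setLIntegral_mono' hset fun t ht => ENNReal.ofReal_le_ofReal ?_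
        have ht1 : Real.exp (-s) ≤ t / d := ht.1
        have ht2 : t / d ≤ 1 := ht.2
        have e1 : 1 ≤ Real.exp s := Real.one_le_exp hs0'
        have e2 : Real.exp (-s) ≤ 1 := Real.exp_le_one_iff.2 (by linarith)
        have ht0 : 0 ≤ t / d := (Real.exp_pos _).le.trans ht1
        have hA : |f t| ≤ M := by
          have := hnear (t / d) ht1 (ht2.trans e1)
          rwa [div_mul_cancel₀ t hd] at this
        have hB : |f (Real.exp s * t)| ≤ M := by
          have := hnear (Real.exp s * (t / d)) (by nlinarith)
            (by nlinarith [Real.exp_pos s])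
          rwa [mul_assoc, div_mul_cancel₀ t hd] at this
        rw [← sq_abs]
        refine pow_le_pow_left₀ (abs_nonneg _) ((abs_sub _ _).trans (add_le_add ?_ hA)) 2
        rw [dilate, abs_mul, abs_of_pos (Real.exp_pos _)]
        exact mul_le_mul (Real.exp_le_exp.2 (by linarith)) hB (abs_nonneg _) (Real.exp_pos _).le
    _ = ENNReal.ofReal ((Real.exp 1 * M + M) ^ 2 * |d| * (1 - Real.exp (-s))) := by
        rw [setLIntegral_const, volume_div_mem_Icc hd, ENNReal.ofReal_mul (by positivity),
          ENNReal.ofReal_mul (by positivity), mul_assoc]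
    _ ≤ _ := by
        refine ENNReal.ofReal_le_ofReal (mul_le_mul_of_nonneg_left ?_ (by positivity))
        have := Real.add_one_le_exp (-s)
        linarith

/-- Upper bound for the displacement under small dilations of a piecewise `C¹` function with jumps
in `T`. -/
theorem exists_norm_dilateLp_sub_sq_le (hf : MemLp f 2 volume)
    (hf' : MemLp (fun t => t * deriv f t) 2 volume)
    (hS : S.Finite) (hfS : ContDiffOn ℝ 1 f Sᶜ) (T : Finset ℝ) (hT : ∀ d ∈ T, d ≠ 0)
    (hc : ∀ t, t ≠ 0 → t ∉ T → ContinuousAt f t)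
    (hb : ∀ d ∈ T, ∃ M, ∀ᶠ t in 𝓝 d, |f t| ≤ M) :
    ∃ (A : ℝ) (C : ℝ → ℝ), ∀ᶠ s in 𝓝[≥] (0 : ℝ),
      ‖dilateLp hf s - dilateLp hf 0‖ ^ 2 ≤ A * s ^ 2 + (∑ d ∈ T, C d) * s := by
  have hfm : Measurable f := measurable_of_continuousOn_compl_finite hS hfS.continuousOn
  have hG := hf.dilationGenerator hf'
  have hex : ∀ d, ∃ C : ℝ, d ∈ T → 0 ≤ C ∧ ∀ᶠ s in 𝓝[≥] (0 : ℝ),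
      ∫⁻ t in {t | t / d ∈ Set.Icc (Real.exp (-s)) 1}, ENNReal.ofReal ((dilate f s t - f t) ^ 2) ≤
        ENNReal.ofReal (C * s) := fun d => by
    by_cases hd : d ∈ T
    · obtain ⟨M, hM⟩ := hb d hd
      obtain ⟨C, hC⟩ := exists_setLIntegral_sq_dilate_sub_le (hT d hd) hM
      exact ⟨C, fun _ => hC⟩
    · exact ⟨0, fun h => absurd h hd⟩
  choose C hC using hex
  refine ⟨∫ t, dilationGenerator f t ^ 2, C, ?_⟩
  have hall : ∀ᶠ s in 𝓝[≥] (0 : ℝ), ∀ d ∈ T,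
      ∫⁻ t in {t | t / d ∈ Set.Icc (Real.exp (-s)) 1}, ENNReal.ofReal ((dilate f s t - f t) ^ 2) ≤
        ENNReal.ofReal (C d * s) := (Finset.eventually_all T).2 fun d hd => (hC d hd).2
  filter_upwards [hall, self_mem_nhdsWithin] with s hs hs0
  have hs0' : 0 ≤ s := hs0
  have hI0 : 0 ≤ ∫ t, dilationGenerator f t ^ 2 := integral_nonneg fun t => sq_nonneg _
  have hCs : 0 ≤ ∑ d ∈ T, C d * s :=
    Finset.sum_nonneg fun d hd => mul_nonneg (hC d hd).1 hs0'
  have hdm : Measurable (dilate f s) := by unfold dilate; fun_prop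
  rw [norm_dilateLp_sub_sq, dilate_zero, integral_eq_lintegral_of_nonneg_ae
    (Eventually.of_forall fun t => sq_nonneg _)
    (f := fun t => (dilate f s t - f t) ^ 2)
    ((hdm.sub hfm).pow_const 2).aestronglyMeasurable]
  refine ENNReal.toReal_le_of_le_ofReal (by rw [Finset.sum_mul]; positivity) ?_
  rw [Finset.sum_mul, ENNReal.ofReal_add (by positivity) hCs, ENNReal.ofReal_sum_of_nonneg
    fun d hd => mul_nonneg (hC d hd).1 hs0']
  let B : ℝ → Set ℝ := fun d => {t | t / d ∈ Set.Icc (Real.exp (-s)) 1}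
  have hB : ∀ d, MeasurableSet (B d) := fun d => (measurable_id.div_const d) measurableSet_Icc
  -- Either the path of `t` meets some `d ∈ T`, and the matching indicator on the right already
  -- contains the left side, or the path avoids all discontinuities and the generator bound applies.
  have hpt : ∀ t, t ≠ 0 → ENNReal.ofReal ((dilate f s t - f t) ^ 2) ≤
      ENNReal.ofReal s *
        (∫⁻ σ in Set.Ioc 0 s, ENNReal.ofReal (dilate (dilationGenerator f) σ t ^ 2)) +
      ∑ d ∈ T, (B d).indicator (fun t => ENNReal.ofReal ((dilate f s t - f t) ^ 2)) t :=
    fun t ht => by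
      by_cases hbad : ∃ d ∈ T, t ∈ B d
      · obtain ⟨d, hd, htd⟩ := hbad
        refine le_add_left ?_
        refine le_trans ?_ (Finset.single_le_sum (f := fun d => (B d).indicator
          (fun t => ENNReal.ofReal ((dilate f s t - f t) ^ 2)) t) (fun _ _ => bot_le) hd)
        simp only [Set.indicator_of_mem htd, le_refl]
      · refine le_add_right (ofReal_sq_dilate_sub_le hS
          (fun t ht => hfS.hasDerivAt_of_notMem_finite hS ht) hfm hs0' ht fun σ hσ => ?_)
        refine hc _ (mul_ne_zero (Real.exp_pos σ).ne' ht) fun hmem => hbad ⟨_, hmem, ?_⟩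
        change t / (Real.exp σ * t) ∈ Set.Icc (Real.exp (-s)) 1
        have : t / (Real.exp σ * t) = Real.exp (-σ) := by
          rw [Real.exp_neg]; field_simp
        rw [this]
        exact ⟨Real.exp_le_exp.2 (by linarith [hσ.2]), Real.exp_le_one_iff.2 (by linarith [hσ.1])⟩
  have hmm : Measurable fun t => ENNReal.ofReal ((dilate f s t - f t) ^ 2) := by fun_prop
  have hae : ∀ᵐ t : ℝ, t ≠ 0 := by simp [ae_iff]
  have hgm : Measurable fun t => ENNReal.ofReal s *
        (∫⁻ σ in Set.Ioc 0 s, ENNReal.ofReal (dilate (dilationGenerator f) σ t ^ 2)) := by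
    have := measurable_dilationGenerator hfm
    refine Measurable.const_mul (Measurable.lintegral_prod_right' (ν := volume.restrict (Set.Ioc 0 s))
      (f := fun z : ℝ × ℝ => ENNReal.ofReal (dilate (dilationGenerator f) z.2 z.1 ^ 2)) ?_) _
    unfold dilate
    fun_prop
  refine (lintegral_mono_ae (hae.mono hpt)).trans ?_
  rw [lintegral_add_left hgm, lintegral_finsetSum _ fun d _ => hmm.indicator (hB d),
    lintegral_const_mul' _ _ ENNReal.ofReal_ne_top,
    lintegral_lintegral_dilate_sq (measurable_dilationGenerator hfm), ← mul_assoc,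
    ← ENNReal.ofReal_mul hs0', ← sq, mul_comm (∫ t, _) _, ENNReal.ofReal_mul (sq_nonneg _),
    ofReal_integral_eq_lintegral_ofReal hG.integrable_sq (Eventually.of_forall fun t => sq_nonneg _)]
  refine add_le_add le_rfl (Finset.sum_le_sum fun d hd => ?_)
  rw [lintegral_indicator (hB d)]
  exact hs d hd

end Generator

/-! ### One-sided limits, and the lower bound forced by a jump -/

section Jumps

variable {f : ℝ → ℝ} {S : Set ℝ}

/-- The extension is a primitive of `deriv f` based at the midpoint; integrability of the derivative
makes it continuous up to the endpoints. -/
theorem exists_continuousOn_Icc_eqOn_Ioo {a b : ℝ} (hab : a < b)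
    (hd : ∀ t ∈ Set.Ioo a b, HasDerivAt f (deriv f t) t)
    (hi : IntegrableOn (deriv f) (Set.Ioo a b)) :
    ∃ h : ℝ → ℝ, ContinuousOn h (Set.Icc a b) ∧ Set.EqOn f h (Set.Ioo a b) := by
  have hii : IntervalIntegrable (deriv f) volume a b :=
    (intervalIntegrable_iff_integrableOn_Ioo_of_le hab.le).2 hi
  have hm : (a + b) / 2 ∈ Set.Ioo a b := ⟨by linarith, by linarith⟩
  refine ⟨fun x => f ((a + b) / 2) + ∫ y in ((a + b) / 2)..x, deriv f y, ?_, fun x hx => ?_⟩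
  · refine continuousOn_const.add ?_
    have := intervalIntegral.continuousOn_primitive_interval' hii
      (by rw [Set.uIcc_of_le hab.le]; exact Set.Ioo_subset_Icc_self hm)
    rwa [Set.uIcc_of_le hab.le] at this
  · have hsub : Set.uIcc ((a + b) / 2) x ⊆ Set.Ioo a b := Set.ordConnected_Ioo.uIcc_subset hm hx
    simp only
    rw [intervalIntegral.integral_eq_sub_of_hasDerivAt (fun t ht => hd t (hsub ht))
      (hii.mono_set (by rw [Set.uIcc_of_le hab.le]; exact hsub.trans Set.Ioo_subset_Icc_self))]
    ring

theorem integrableOn_deriv_of_memLp_mul (hf' : MemLp (fun t => t * deriv f t) 2 volume) {a b δ : ℝ}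
    (hδ : 0 < δ) (h : ∀ t ∈ Set.Ioo a b, δ ≤ |t|) : IntegrableOn (deriv f) (Set.Ioo a b) := by
  have h1 : IntegrableOn (fun t => t * deriv f t) (Set.Ioo a b) :=
    (hf'.restrict _).integrable one_le_two
  refine Integrable.mono' (h1.norm.const_mul δ⁻¹) (measurable_deriv f).aestronglyMeasurable ?_
  refine (ae_restrict_iff' measurableSet_Ioo).2 (Eventually.of_forall fun t ht => ?_)
  rw [norm_mul, ← mul_assoc, Real.norm_eq_abs t]
  refine le_mul_of_one_le_left (norm_nonneg _) ?_
  rw [inv_mul_eq_div, one_le_div hδ]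
  exact h t ht

/-- A one-sided neighbourhood of `d` avoids `S` and stays away from `0`. There the hypothesis on `t
f'(t)` makes `f'` integrable, so `f` extends continuously to `d`. -/
theorem exists_tendsto_nhdsGT (hf' : MemLp (fun t => t * deriv f t) 2 volume)
    (hS : S.Finite) (hfS : ContDiffOn ℝ 1 f Sᶜ) {d : ℝ} (hd : d ≠ 0) :
    ∃ l, Tendsto f (𝓝[>] d) (𝓝 l) := by
  have h1 : ∀ᶠ t in 𝓝[>] d, t ∉ S ∧ |d| / 2 ≤ |t| := by
    refine Eventually.and ?_ ?_
    · have : ∀ᶠ t in 𝓝[≠] d, t ∉ S := by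
        have := (hS.subset (Set.sdiff_subset (t := {d}))).isClosed.isOpen_compl.mem_nhds
          (show d ∈ (S \ {d})ᶜ by simp)
        filter_upwards [nhdsWithin_le_nhds this, self_mem_nhdsWithin] with t ht ht' hts
        exact ht ⟨hts, ht'⟩
      exact nhdsWithin_mono _ (fun t ht => ne_of_gt ht) this
    · have := (continuous_abs.tendsto d).eventually (lt_mem_nhds (half_lt_self (abs_pos.2 hd)))
      exact nhdsWithin_le_nhds (this.mono fun t ht => ht.le)
  obtain ⟨c, hc, hcs⟩ := mem_nhdsGT_iff_exists_Ioo_subset.1 h1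
  have hdc : d < c := hc
  obtain ⟨h, hh, he⟩ := exists_continuousOn_Icc_eqOn_Ioo hdc
    (fun t ht => hfS.hasDerivAt_of_notMem_finite hS (hcs ht).1)
    (integrableOn_deriv_of_memLp_mul hf' (half_pos (abs_pos.2 hd)) fun t ht => (hcs ht).2)
  refine ⟨h d, ?_⟩
  have := (hh d (Set.left_mem_Icc.2 hdc.le)).mono Set.Ioo_subset_Icc_self
  rw [ContinuousWithinAt, nhdsWithin_Ioo_eq_nhdsGT hdc] at this
  refine this.congr' ?_
  filter_upwards [Ioo_mem_nhdsGT hdc] with t ht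
  exact (he ht).symm

theorem exists_tendsto_nhdsLT (hf' : MemLp (fun t => t * deriv f t) 2 volume)
    (hS : S.Finite) (hfS : ContDiffOn ℝ 1 f Sᶜ) {d : ℝ} (hd : d ≠ 0) :
    ∃ l, Tendsto f (𝓝[<] d) (𝓝 l) := by
  have h1 : ∀ᶠ t in 𝓝[<] d, t ∉ S ∧ |d| / 2 ≤ |t| := by
    refine Eventually.and ?_ ?_
    · have : ∀ᶠ t in 𝓝[≠] d, t ∉ S := by
        have := (hS.subset (Set.sdiff_subset (t := {d}))).isClosed.isOpen_compl.mem_nhds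
          (show d ∈ (S \ {d})ᶜ by simp)
        filter_upwards [nhdsWithin_le_nhds this, self_mem_nhdsWithin] with t ht ht' hts
        exact ht ⟨hts, ht'⟩
      exact nhdsWithin_mono _ (fun t ht => ne_of_lt ht) this
    · have := (continuous_abs.tendsto d).eventually (lt_mem_nhds (half_lt_self (abs_pos.2 hd)))
      exact nhdsWithin_le_nhds (this.mono fun t ht => ht.le)
  obtain ⟨c, hc, hcs⟩ := mem_nhdsLT_iff_exists_Ioo_subset.1 h1
  have hdc : c < d := hc
  obtain ⟨h, hh, he⟩ := exists_continuousOn_Icc_eqOn_Ioo hdc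
    (fun t ht => hfS.hasDerivAt_of_notMem_finite hS (hcs ht).1)
    (integrableOn_deriv_of_memLp_mul hf' (half_pos (abs_pos.2 hd)) fun t ht => (hcs ht).2)
  refine ⟨h d, ?_⟩
  have := (hh d (Set.right_mem_Icc.2 hdc.le)).mono Set.Ioo_subset_Icc_self
  rw [ContinuousWithinAt, nhdsWithin_Ioo_eq_nhdsLT hdc] at this
  refine this.congr' ?_
  filter_upwards [Ioo_mem_nhdsLT hdc] with t ht
  exact (he ht).symm

theorem exists_eventually_abs_le (hf' : MemLp (fun t => t * deriv f t) 2 volume)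
    (hS : S.Finite) (hfS : ContDiffOn ℝ 1 f Sᶜ) {d : ℝ} (hd : d ≠ 0) :
    ∃ M, ∀ᶠ t in 𝓝 d, |f t| ≤ M := by
  obtain ⟨l, hl⟩ := exists_tendsto_nhdsLT hf' hS hfS hd
  obtain ⟨r, hr⟩ := exists_tendsto_nhdsGT hf' hS hfS hd
  have h1 := hl.abs.eventually (gt_mem_nhds (lt_add_one |l|))
  have h2 := hr.abs.eventually (gt_mem_nhds (lt_add_one |r|))
  refine ⟨max |f d| (max (|l| + 1) (|r| + 1)), ?_⟩
  rw [← nhdsNE_sup_pure, ← nhdsLT_sup_nhdsGT, eventually_sup, eventually_sup]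
  refine ⟨⟨h1.mono fun t ht => ?_, h2.mono fun t ht => ?_⟩, ?_⟩
  · exact ht.le.trans ((le_max_left _ _).trans (le_max_right _ _))
  · exact ht.le.trans ((le_max_right _ _).trans (le_max_right _ _))
  · exact eventually_pure.2 (le_max_left _ _)

/-- Lower bound for the displacement under small dilations of a function with a jump. -/
theorem exists_mul_le_norm_dilateLp_sub_sq (hf : MemLp f 2 volume) {d l₁ l₂ : ℝ} (hd : d ≠ 0)
    (h1 : Tendsto (fun x => f (x * d)) (𝓝[<] 1) (𝓝 l₁))
    (h2 : Tendsto (fun x => f (x * d)) (𝓝[>] 1) (𝓝 l₂)) (hne : l₁ ≠ l₂) :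
    ∃ c : ℝ, 0 < c ∧ ∀ᶠ s in 𝓝[≥] (0 : ℝ), c * s ≤ ‖dilateLp hf s - dilateLp hf 0‖ ^ 2 := by
  -- A quarter of the jump: on the crossing set each of `f` and its dilate is within `η` of its own
  -- one-sided limit, so they differ by at least `2η`.
  obtain ⟨η, hη, hη4⟩ : ∃ η, 0 < η ∧ |l₂ - l₁| = 4 * η :=
    ⟨|l₂ - l₁| / 4, by have := abs_pos.2 (sub_ne_zero.2 hne.symm); positivity, by ring⟩
  have h1' : ∀ᶠ x in 𝓝[<] (1 : ℝ), |f (x * d) - l₁| < η := by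
    simpa [Real.dist_eq] using h1.eventually (Metric.ball_mem_nhds l₁ hη)
  have h2' : ∀ᶠ z in 𝓝 (0 : ℝ) ×ˢ 𝓝[>] (1 : ℝ), |Real.exp (z.1 / 2) * f (z.2 * d) - l₂| < η := by
    have ha : Tendsto (fun z : ℝ × ℝ => Real.exp (z.1 / 2)) (𝓝 (0 : ℝ) ×ˢ 𝓝[>] (1 : ℝ)) (𝓝 1) := by
      have : Continuous fun s : ℝ => Real.exp (s / 2) := by fun_prop
      have h := this.tendsto 0
      rw [zero_div, Real.exp_zero] at h
      exact h.comp tendsto_fst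
    have hb := ha.mul (h2.comp (tendsto_snd (f := 𝓝 (0 : ℝ))))
    rw [one_mul] at hb
    simpa [Real.dist_eq] using hb.eventually (Metric.ball_mem_nhds l₂ hη)
  obtain ⟨P, hP, Q, hQ, hPQ⟩ := eventually_prod_iff.1 h2'
  obtain ⟨a, ha, hax⟩ := mem_nhdsLT_iff_exists_Ioo_subset.1 h1'
  obtain ⟨b, hb, hbx⟩ := mem_nhdsGT_iff_exists_Ioo_subset.1 hQ
  have ha' : a < 1 := ha
  have hb' : 1 < b := hb
  have hs1 : ∀ᶠ s : ℝ in 𝓝 0, a < Real.exp (-s) := by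
    have : Continuous fun s : ℝ => Real.exp (-s) := by fun_prop
    exact (this.tendsto 0).eventually (lt_mem_nhds (by simpa using ha'))
  have hs2 : ∀ᶠ s : ℝ in 𝓝 0, Real.exp s < b :=
    (Real.continuous_exp.tendsto 0).eventually (gt_mem_nhds (by simpa using hb'))
  -- This is `(2η) ^ 2` times `|d| / 2`, the crossing set having measure `|d| (1 - e^{-s}) ≥ |d| s /
  -- 2` for `0 ≤ s < 1`.
  refine ⟨2 * η ^ 2 * |d|, by positivity, ?_⟩
  filter_upwards [nhdsWithin_le_nhds hP, nhdsWithin_le_nhds hs1, nhdsWithin_le_nhds hs2,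
    nhdsWithin_le_nhds (gt_mem_nhds (one_pos : (0 : ℝ) < 1)), self_mem_nhdsWithin]
    with s hPs hsa hsb hs1 hs0
  have hs0' : 0 ≤ s := hs0
  have hset : MeasurableSet {t : ℝ | t / d ∈ Set.Ioo (Real.exp (-s)) 1} :=
    (measurable_id.div_const d) measurableSet_Ioo
  have hvol := volume_div_mem_Ioo hd (Real.exp (-s)) 1
  have hexp : s / 2 ≤ 1 - Real.exp (-s) := by
    have h3 := Real.add_one_le_exp s
    have h4 : Real.exp (-s) * Real.exp s = 1 := by rw [← Real.exp_add]; simp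
    nlinarith [Real.exp_pos (-s)]
  have hint : Integrable fun t => (dilate f s t - f t) ^ 2 := ((hf.dilate s).sub hf).integrable_sq
  rw [norm_dilateLp_sub_sq, dilate_zero]
  have hpt : ∀ t ∈ {t : ℝ | t / d ∈ Set.Ioo (Real.exp (-s)) 1},
      (2 * η) ^ 2 ≤ (dilate f s t - f t) ^ 2 := fun t ht => by
    have ht1 : Real.exp (-s) < t / d := ht.1
    have ht2 : t / d < 1 := ht.2
    have hA := hax ⟨hsa.trans ht1, ht2⟩
    have hpos : 1 < Real.exp s * (t / d) := by
      have h4 : Real.exp s * Real.exp (-s) = 1 := by rw [← Real.exp_add]; simp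
      rw [← h4]
      exact mul_lt_mul_of_pos_left ht1 (Real.exp_pos s)
    have hlt : Real.exp s * (t / d) < b := by
      refine lt_trans ?_ hsb
      nlinarith [Real.exp_pos s]
    have hB := hPQ hPs (hbx ⟨hpos, hlt⟩)
    have hA' : |f (t / d * d) - l₁| < η := hA
    rw [div_mul_cancel₀ t hd] at hA'
    have hB' : |Real.exp (s / 2) * f (Real.exp s * (t / d) * d) - l₂| < η := hB
    rw [mul_assoc (Real.exp s), div_mul_cancel₀ t hd] at hB'
    rw [← sq_abs (dilate f s t - f t)]
    refine pow_le_pow_left₀ (by positivity) ?_ 2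
    have h5 : |l₂ - l₁| ≤ |dilate f s t - f t| + |Real.exp (s / 2) * f (Real.exp s * t) - l₂| +
        |f t - l₁| := by
      have e : l₂ - l₁ = (dilate f s t - f t) - (Real.exp (s / 2) * f (Real.exp s * t) - l₂) +
          (f t - l₁) := by rw [dilate]; ring
      rw [e]
      exact (abs_add_le _ _).trans (add_le_add (abs_sub _ _) le_rfl)
    linarith
  calc 2 * η ^ 2 * |d| * s ≤ (2 * η) ^ 2 * (|d| * (1 - Real.exp (-s))) := by
        have := mul_le_mul_of_nonneg_left hexp (by positivity : 0 ≤ 4 * η ^ 2 * |d|)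
        nlinarith
    _ = (2 * η) ^ 2 * volume.real {t : ℝ | t / d ∈ Set.Ioo (Real.exp (-s)) 1} := by
        rw [measureReal_def, hvol, ENNReal.toReal_mul, ENNReal.toReal_ofReal (abs_nonneg _),
          ENNReal.toReal_ofReal (by linarith)]
    _ ≤ ∫ t in {t : ℝ | t / d ∈ Set.Ioo (Real.exp (-s)) 1}, (dilate f s t - f t) ^ 2 := by
        refine setIntegral_ge_of_const_le_real hset ?_ hpt hint.integrableOn
        rw [hvol]
        exact ENNReal.mul_ne_top ENNReal.ofReal_ne_top ENNReal.ofReal_ne_top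
    _ ≤ _ := setIntegral_le_integral hint (Eventually.of_forall fun t => sq_nonneg _)

end Jumps

/-! ### From weights to dilation parameters -/

section Main

/-- For `|x| < 1`, `|1 - e^x|` and `|x|` agree up to a factor `2`; summability on either side forces
`x n → 0`, so the comparison holds eventually. The exponents `k = 2` and `k = 1` serve the
square-summable and the absolutely summable conditions. -/
theorem summable_abs_one_sub_exp_pow_iff {x : ℕ → ℝ} {k : ℕ} :
    Summable (fun n => |1 - Real.exp (x n)| ^ k) ↔
      Tendsto x atTop (𝓝 0) ∧ Summable fun n => |x n| ^ k := by
  have tendsto_of_summable : ∀ {y : ℕ → ℝ}, Summable (fun n => |y n| ^ k) → Tendsto y atTop (𝓝 0) :=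
    fun {y} hy => by
      have h := hy.tendsto_atTop_zero
      rw [tendsto_zero_iff_abs_tendsto_zero]
      rw [Metric.tendsto_nhds] at h ⊢
      intro ε hε
      filter_upwards [h (ε ^ k) (by positivity)] with n hn
      simp only [Function.comp_apply, Real.dist_eq, sub_zero, abs_abs, abs_pow] at hn ⊢
      exact lt_of_pow_lt_pow_left₀ k hε.le hn
  have hev : Tendsto x atTop (𝓝 0) → ∀ᶠ n in atTop, |x n| < 1 := fun h => by
    have := h.abs
    rw [abs_zero] at this
    exact this.eventually (gt_mem_nhds one_pos)
  constructor
  · intro h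
    have h0 := tendsto_of_summable h
    have h1 : Tendsto (fun n => Real.exp (x n)) atTop (𝓝 1) := by
      have := h0.const_sub 1
      simpa using this
    have h2 : Tendsto x atTop (𝓝 0) := by
      have := (Real.continuousAt_log one_ne_zero).tendsto.comp h1
      rw [Real.log_one] at this
      exact this.congr fun n => Real.log_exp _
    refine ⟨h2, Summable.of_norm_bounded_eventually_nat (h.mul_left (2 ^ k)) ?_⟩
    filter_upwards [hev h2] with n hn
    rw [norm_pow, Real.norm_eq_abs, abs_abs, ← mul_pow]
    refine pow_le_pow_left₀ (abs_nonneg _) ?_ k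
    generalize x n = y at hn
    have e1 := Real.add_one_le_exp y
    have e2 := Real.add_one_le_exp (-y)
    have e3 : Real.exp y * Real.exp (-y) = 1 := by rw [← Real.exp_add]; simp
    rw [abs_lt] at hn
    rcases le_total 0 y with hy | hy
    · rw [abs_of_nonneg hy, abs_of_nonpos (by linarith)]
      linarith
    · have : Real.exp y ≤ 1 := Real.exp_le_one_iff.2 hy
      rw [abs_of_nonpos hy, abs_of_nonneg (by linarith)]
      nlinarith [Real.exp_pos y]
  · rintro ⟨h0, h⟩
    refine Summable.of_norm_bounded_eventually_nat (h.mul_left (2 ^ k)) ?_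
    filter_upwards [hev h0] with n hn
    rw [norm_pow, Real.norm_eq_abs, abs_abs, ← mul_pow, abs_sub_comm]
    exact pow_le_pow_left₀ (abs_nonneg _) (Real.abs_exp_sub_one_le hn.le) k

variable {p q : ℝ → ℝ}

theorem memLp_sqrt_of_withDensity {κ : Measure ℝ} [IsProbabilityMeasure κ] (hp : AEMeasurable p)
    (hp0 : ∀ t, 0 ≤ p t) (hκ : κ = volume.withDensity fun t => ENNReal.ofReal (p t)) :
    MemLp (fun t => √(p t)) 2 volume ∧ ∫ t, √(p t) ^ 2 = 1 := by
  have h1 : ∫⁻ t, ENNReal.ofReal (p t) = 1 := by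
    have := measure_univ (μ := κ)
    rwa [hκ, withDensity_apply _ MeasurableSet.univ, Measure.restrict_univ] at this
  have hi : Integrable p := by
    refine ⟨hp.aestronglyMeasurable, ?_⟩
    rw [hasFiniteIntegral_iff_ofReal (Eventually.of_forall hp0), h1]
    exact ENNReal.one_lt_top
  constructor
  · refine (memLp_two_iff_integrable_sq hp.sqrt.aestronglyMeasurable).2 ?_
    simpa only [Real.sq_sqrt (hp0 _)] using hi
  · simp_rw [Real.sq_sqrt (hp0 _)]
    rw [integral_eq_lintegral_of_nonneg_ae (Eventually.of_forall hp0) hi.aestronglyMeasurable, h1,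
      ENNReal.toReal_one]

theorem weightRatio_pos {u v : ℕ → ℝ} (hu : IsPositiveWeight u) (hv : IsPositiveWeight v) (n : ℕ) :
    0 < weightRatio u v n :=
  div_pos (hu.prod_pos n) (hv.prod_pos n)

variable {r : ℝ≥0∞} [Fact (1 ≤ r)] {u v : ℕ → ℝ} {hu : IsPositiveWeight u}
  {hv : IsPositiveWeight v} {μ ν : ℕ → Measure ℝ} [∀ n, IsProbabilityMeasure (μ n)]
  [∀ n, IsProbabilityMeasure (ν n)] {mu mv : Measure (RealEll r)}

theorem IsProductMeasure.eq_withDensity_dilate_sq (hmu : IsProductMeasure mu μ)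
    (hinv : MeasurePreserving (backwardShift r u hu) mu mu) (hp : AEMeasurable p)
    (hp0 : ∀ t, 0 ≤ p t) (hμp : μ 0 = volume.withDensity fun t => ENNReal.ofReal (p t)) (n : ℕ) :
    μ n = volume.withDensity fun t => ENNReal.ofReal
      (dilate (fun t => √(p t)) (Real.log (∏ i ∈ Finset.Icc 1 n, u i)) t ^ 2) := by
  rw [eq_withDensity_of_map_mul_eq (hu.prod_pos n) hp.ennreal_ofReal (hmu.map_prod_mul hinv n) hμp]
  congr 1
  ext t
  rw [dilate_sq, Real.exp_log (hu.prod_pos n), Real.sq_sqrt (hp0 _),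
    ENNReal.ofReal_mul (hu.prod_pos n).le]

/-- Non-orthogonality of the two product measures in terms of the dilation orbit of `√p`. -/
theorem not_mutuallySingular_iff_summable_dilateLp (hr : r ≠ ∞)
    (hmu : IsProductMeasure mu μ) (hmv : IsProductMeasure mv ν)
    (hinvu : MeasurePreserving (backwardShift r u hu) mu mu)
    (hinvv : MeasurePreserving (backwardShift r v hv) mv mv)
    (hp : AEMeasurable p) (hq : AEMeasurable q) (hp0 : ∀ t, 0 ≤ p t) (hq0 : ∀ t, 0 ≤ q t)
    (hμp : μ 0 = volume.withDensity fun t => ENNReal.ofReal (p t))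
    (hνq : ν 0 = volume.withDensity fun t => ENNReal.ofReal (q t))
    (hf : MemLp (fun t => √(p t)) 2 volume) (hg : MemLp (fun t => √(q t)) 2 volume)
    (hf1 : ∫ t, √(p t) ^ 2 = 1) (hg1 : ∫ t, √(q t) ^ 2 = 1) :
    ¬ mu ⟂ₘ mv ↔ (∀ n, ¬ μ n ⟂ₘ ν n) ∧
      Summable fun n => ‖dilateLp hf (Real.log (weightRatio u v n)) - dilateLp hg 0‖ ^ 2 := by
  rw [hmu.mutuallySingular_iff hr hmv, not_infinitePi_mutuallySingular_iff
    (ρ := (volume : Measure ℝ))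
    (F := fun n => dilate (fun t => √(p t)) (Real.log (∏ i ∈ Finset.Icc 1 n, u i)))
    (G := fun n => dilate (fun t => √(q t)) (Real.log (∏ i ∈ Finset.Icc 1 n, v i)))
    (fun n => (hf.dilate _).1.aemeasurable) (fun n => (hg.dilate _).1.aemeasurable)
    (fun n t => mul_nonneg (Real.exp_pos _).le (Real.sqrt_nonneg _))
    (fun n t => mul_nonneg (Real.exp_pos _).le (Real.sqrt_nonneg _)) μ ν
    (hmu.eq_withDensity_dilate_sq hinvu hp hp0 hμp) (hmv.eq_withDensity_dilate_sq hinvv hq hq0 hνq)]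
  refine and_congr_right fun _ => ?_
  -- The factor `2` turns `1 - affinity` into the squared distance of unit vectors.
  rw [← summable_mul_left_iff (two_ne_zero (α := ℝ))]
  refine iff_of_eq (congrArg Summable (funext fun n => ?_))
  rw [dilateLp, dilateLp, norm_toLp_sub_sq_of_unit _ _ ((integral_dilate_sq _ _).trans hf1)
    ((integral_dilate_sq _ _).trans hg1), dilate_zero, weightRatio,
    Real.log_div (hu.prod_pos n).ne' (hv.prod_pos n).ne',
    ← integral_dilate_mul_dilate _ (fun t => √(q t)) (_ - _)
      (Real.log (∏ i ∈ Finset.Icc 1 n, v i)), sub_add_cancel]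

theorem dilateLp_eq_iff (hp0 : ∀ t, 0 ≤ p t) (hq0 : ∀ t, 0 ≤ q t)
    (hf : MemLp (fun t => √(p t)) 2 volume) (hg : MemLp (fun t => √(q t)) 2 volume) {a : ℝ}
    (ha : 0 < a) :
    dilateLp hg 0 = dilateLp hf (Real.log a) ↔ ∀ᵐ t, q t = a * p (a * t) := by
  rw [dilateLp, dilateLp, MemLp.toLp_eq_toLp_iff, dilate_zero]
  refine eventually_congr (Eventually.of_forall fun t => ?_)
  have h : 0 ≤ dilate (fun t => √(p t)) (Real.log a) t :=
    mul_nonneg (Real.exp_pos _).le (Real.sqrt_nonneg _)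
  rw [← sq_eq_sq₀ (Real.sqrt_nonneg _) h, Real.sq_sqrt (hq0 t), dilate_sq, Real.exp_log ha,
    Real.sq_sqrt (hp0 _)]

theorem summable_one_sub_ratio_pow_iff (hu : IsPositiveWeight u) (hv : IsPositiveWeight v) {a : ℝ}
    (ha : 0 < a) {k : ℕ} :
    Summable (fun n => |1 - 1 / a * weightRatio u v (n + 1)| ^ k) ↔
      Tendsto (fun n => Real.log (weightRatio u v n) - Real.log a) atTop (𝓝 0) ∧
        Summable fun n => |Real.log (weightRatio u v n) - Real.log a| ^ k := by
  rw [summable_nat_add_iff (f := fun n => |1 - 1 / a * weightRatio u v n| ^ k) 1,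
    ← summable_abs_one_sub_exp_pow_iff]
  refine iff_of_eq (congrArg Summable (funext fun n => ?_))
  rw [Real.exp_sub, Real.exp_log (weightRatio_pos hu hv n), Real.exp_log ha, one_div_mul_eq_div]

/-- Displacements depend only on the parameter difference, so an estimate near `0` transfers to `b`.
The predicate `P` lets upper and lower bounds use the same transfer. -/
theorem Filter.Tendsto.eventually_norm_dilateLp {f : ℝ → ℝ} (hf : MemLp f 2 volume) {s : ℕ → ℝ}
    {b : ℝ} (hs : Tendsto (fun n => s n - b) atTop (𝓝 0)) {P : ℝ → ℝ → Prop}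
    (h : ∀ᶠ x in 𝓝[≥] (0 : ℝ), P x (‖dilateLp hf x - dilateLp hf 0‖ ^ 2)) :
    ∀ᶠ n in atTop, P |s n - b| (‖dilateLp hf (s n) - dilateLp hf b‖ ^ 2) := by
  have h1 : Tendsto (fun n => |s n - b|) atTop (𝓝[≥] 0) := by
    refine tendsto_nhdsWithin_iff.2 ⟨?_, Eventually.of_forall fun n => Set.mem_Ici.2 (abs_nonneg _)⟩
    simpa using hs.abs
  filter_upwards [h1.eventually h] with n hn
  rwa [norm_dilateLp_sub_eq]

/-- If the one-sided limits of `√p` agreed, their squared common value would be a limit of `p` at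
`d`. Scaling by `d` exchanges the two sides when `d < 0`. -/
theorem exists_tendsto_mul_of_hasEssentialDiscontinuityAt (hp0 : ∀ t, 0 ≤ p t) {S : Set ℝ}
    (hS : S.Finite) (hfS : ContDiffOn ℝ 1 (fun t => √(p t)) Sᶜ)
    (hf' : MemLp (fun t => t * deriv (fun s => √(p s)) t) 2 volume) {d : ℝ} (hd : d ≠ 0)
    (hdisc : HasEssentialDiscontinuityAt p d) :
    ∃ l₁ l₂, Tendsto (fun x => √(p (x * d))) (𝓝[<] 1) (𝓝 l₁) ∧
      Tendsto (fun x => √(p (x * d))) (𝓝[>] 1) (𝓝 l₂) ∧ l₁ ≠ l₂ := by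
  obtain ⟨l, hl⟩ := exists_tendsto_nhdsLT hf' hS hfS hd
  obtain ⟨m, hm⟩ := exists_tendsto_nhdsGT hf' hS hfS hd
  have hlm : l ≠ m := by
    rintro rfl
    refine hdisc ⟨l ^ 2, ?_⟩
    have h : Tendsto (fun t => √(p t)) (𝓝[≠] d) (𝓝 l) := by
      rw [← nhdsLT_sup_nhdsGT]
      exact hl.sup hm
    exact (h.pow 2).congr fun t => Real.sq_sqrt (hp0 t)
  have hcont : Tendsto (fun x : ℝ => x * d) (𝓝 1) (𝓝 d) := by
    have : Continuous fun x : ℝ => x * d := by fun_prop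
    simpa using this.tendsto 1
  rcases hd.lt_or_gt with hneg | hpos
  · refine ⟨m, l, hm.comp (tendsto_nhdsWithin_iff.2 ⟨hcont.mono_left nhdsWithin_le_nhds, ?_⟩),
      hl.comp (tendsto_nhdsWithin_iff.2 ⟨hcont.mono_left nhdsWithin_le_nhds, ?_⟩), hlm.symm⟩
    · filter_upwards [self_mem_nhdsWithin] with x (hx : x < 1)
      change d < x * d
      nlinarith
    · filter_upwards [self_mem_nhdsWithin] with x (hx : 1 < x)
      change x * d < d
      nlinarith
  · refine ⟨l, m, hl.comp (tendsto_nhdsWithin_iff.2 ⟨hcont.mono_left nhdsWithin_le_nhds, ?_⟩),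
      hm.comp (tendsto_nhdsWithin_iff.2 ⟨hcont.mono_left nhdsWithin_le_nhds, ?_⟩), hlm⟩
    · filter_upwards [self_mem_nhdsWithin] with x (hx : x < 1)
      change x * d < d
      nlinarith
    · filter_upwards [self_mem_nhdsWithin] with x (hx : 1 < x)
      change d < x * d
      nlinarith

end Main

/-! ### The three parts of the theorem -/

theorem theorem5p10 (r : ℝ≥0∞) [Fact (1 ≤ r)] (hr : r ≠ ∞)
    (u v : ℕ → ℝ) (hu : IsPositiveWeight u) (hv : IsPositiveWeight v)
    -- the invariant product measures and their marginals
    (μ ν : ℕ → Measure ℝ) [∀ n, IsProbabilityMeasure (μ n)] [∀ n, IsProbabilityMeasure (ν n)]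
    (mu mv : Measure (RealEll r)) (hmu : IsProductMeasure mu μ) (hmv : IsProductMeasure mv ν)
    (hinvu : MeasurePreserving (backwardShift r u hu) mu mu)
    (hinvv : MeasurePreserving (backwardShift r v hv) mv mv)
    -- the densities of the marginals of index 0
    (p q : ℝ → ℝ) (hp : AEMeasurable p) (hq : AEMeasurable q)
    (hp_nonneg : ∀ t, 0 ≤ p t) (hq_nonneg : ∀ t, 0 ≤ q t)
    (hμp : μ 0 = volume.withDensity (fun t => ENNReal.ofReal (p t)))
    (hνq : ν 0 = volume.withDensity (fun t => ENNReal.ofReal (q t))) :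
    -- part (1)
    (¬ mu ⟂ₘ mv →
      ∃ a : ℝ, 0 < a ∧ Tendsto (weightRatio u v) atTop (𝓝 a) ∧
        (∀ᵐ t, q t = a * p (a * t)) ∧
        Summable (fun n : ℕ => (1 - 1 / a * weightRatio u v (n + 1)) ^ 2)) ∧
    -- part (2)
    (∀ a : ℝ, 0 < a → (∀ᵐ t, q t = a * p (a * t)) →
      ContinuousOn (fun t => √(p t)) {0}ᶜ →
      IsC1ExceptFinite (fun t => √(p t)) →
      MemLp (fun t => t * deriv (fun s => √(p s)) t) 2 →
      (¬ mu ⟂ₘ mv ↔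
        (∀ n, ¬ μ n ⟂ₘ ν n) ∧
        Summable (fun n : ℕ => (1 - 1 / a * weightRatio u v (n + 1)) ^ 2))) ∧
    -- part (3)
    (∀ a : ℝ, 0 < a → (∀ᵐ t, q t = a * p (a * t)) →
      IsC1ExceptFinite (fun t => √(p t)) →
      MemLp (fun t => t * deriv (fun s => √(p s)) t) 2 →
      (∃ t₀ : ℝ, t₀ ≠ 0 ∧ HasEssentialDiscontinuityAt p t₀) →
      (¬ mu ⟂ₘ mv ↔
        (∀ n, ¬ μ n ⟂ₘ ν n) ∧
        Summable (fun n : ℕ => |1 - 1 / a * weightRatio u v (n + 1)|))) := by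
  obtain ⟨hf, hf1⟩ := memLp_sqrt_of_withDensity hp hp_nonneg hμp
  obtain ⟨hg, hg1⟩ := memLp_sqrt_of_withDensity hq hq_nonneg hνq
  have hiff := not_mutuallySingular_iff_summable_dilateLp hr hmu hmv hinvu hinvv hp hq hp_nonneg
    hq_nonneg hμp hνq hf hg hf1 hg1
  have hsq : ∀ a : ℝ, (fun n : ℕ => (1 - 1 / a * weightRatio u v (n + 1)) ^ 2) =
      fun n => |1 - 1 / a * weightRatio u v (n + 1)| ^ 2 := fun a => by simp_rw [sq_abs]
  have habs : ∀ a : ℝ, (fun n : ℕ => |1 - 1 / a * weightRatio u v (n + 1)|) =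
      fun n => |1 - 1 / a * weightRatio u v (n + 1)| ^ 1 := fun a => by simp_rw [pow_one]
  have hfwd : (Summable fun n =>
      ‖dilateLp hf (Real.log (weightRatio u v n)) - dilateLp hg 0‖ ^ 2) →
      ∃ a : ℝ, 0 < a ∧ Tendsto (weightRatio u v) atTop (𝓝 a) ∧
        (∀ᵐ t, q t = a * p (a * t)) ∧
        Tendsto (fun n => Real.log (weightRatio u v n) - Real.log a) atTop (𝓝 0) ∧
        Summable fun n => |Real.log (weightRatio u v n) - Real.log a| ^ 2 := fun hsum => by
    obtain ⟨b, hb, hgb, hbs⟩ := summable_sub_sq_of_summable_dilateLp hf hf1 hsum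
    refine ⟨Real.exp b, Real.exp_pos b, ?_, ?_, ?_, ?_⟩
    · refine ((Real.continuous_exp.tendsto b).comp hb).congr fun n => ?_
      exact Real.exp_log (weightRatio_pos hu hv n)
    · rwa [← dilateLp_eq_iff hp_nonneg hq_nonneg hf hg (Real.exp_pos b), Real.log_exp]
    · rw [Real.log_exp]
      simpa using hb.sub_const b
    · simpa only [Real.log_exp, sq_abs] using hbs
  -- The orbit map is injective, so the limit `a` produced by `hfwd` must be the constant prescribed
  -- in parts (2) and (3).
  have huniq : ∀ a b : ℝ, 0 < a → 0 < b → (∀ᵐ t, q t = a * p (a * t)) →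
      (∀ᵐ t, q t = b * p (b * t)) → a = b := fun a b ha hb hqa hqb => by
    rw [← dilateLp_eq_iff hp_nonneg hq_nonneg hf hg ha] at hqa
    rw [← dilateLp_eq_iff hp_nonneg hq_nonneg hf hg hb] at hqb
    exact Real.log_injOn_pos ha hb (dilateLp_injective hf hf1 (hqa.symm.trans hqb))
  refine ⟨fun h => ?_, fun a ha hqa hcont hC1 hf' => ?_, fun a ha hqa hC1 hf' hdisc => ?_⟩
  · obtain ⟨a, ha, hlim, hqa, h0, hs⟩ := hfwd (hiff.1 h).2
    refine ⟨a, ha, hlim, hqa, ?_⟩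
    rw [hsq]
    exact (summable_one_sub_ratio_pow_iff hu hv ha).2 ⟨h0, hs⟩
  · rw [hiff, hsq, summable_one_sub_ratio_pow_iff hu hv ha]
    refine and_congr_right fun _ => ⟨fun hsum => ?_, fun ⟨h0, hs⟩ => ?_⟩
    · obtain ⟨b, hb, -, hqb, h0, hs⟩ := hfwd hsum
      obtain rfl := huniq a b ha hb hqa hqb
      exact ⟨h0, hs⟩
    · obtain ⟨S, hS, hfS⟩ := hC1
      -- No jumps off `0`: with `T = ∅` only the quadratic term survives.
      obtain ⟨A, C, hAC⟩ := exists_norm_dilateLp_sub_sq_le hf hf' hS hfS ∅ (by simp)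
        (fun t ht _ => hcont.continuousAt (isOpen_compl_singleton.mem_nhds ht)) (by simp)
      rw [(dilateLp_eq_iff hp_nonneg hq_nonneg hf hg ha).2 hqa]
      refine Summable.of_norm_bounded_eventually_nat (hs.mul_left A) ?_
      filter_upwards [h0.eventually_norm_dilateLp hf
        (P := fun x y => y ≤ A * x ^ 2 + (∑ d ∈ ∅, C d) * x) hAC] with n hn
      rw [Real.norm_of_nonneg (sq_nonneg _)]
      simpa using hn
  · obtain ⟨S, hS, hfS⟩ := hC1
    rw [hiff, habs, summable_one_sub_ratio_pow_iff hu hv ha,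
      (dilateLp_eq_iff hp_nonneg hq_nonneg hf hg ha).2 hqa]
    rw [(dilateLp_eq_iff hp_nonneg hq_nonneg hf hg ha).2 hqa] at hfwd
    refine and_congr_right fun _ => ⟨fun hsum => ?_, fun ⟨h0, hs⟩ => ?_⟩
    · obtain ⟨b, hb, -, hqb, h0, -⟩ := hfwd hsum
      obtain rfl := huniq a b ha hb hqa hqb
      refine ⟨h0, ?_⟩
      obtain ⟨d, hd, hdd⟩ := hdisc
      obtain ⟨l₁, l₂, h1, h2, hne⟩ := exists_tendsto_mul_of_hasEssentialDiscontinuityAt hp_nonneg hS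
        hfS hf' hd hdd
      obtain ⟨c, hc, hlow⟩ := exists_mul_le_norm_dilateLp_sub_sq hf hd h1 h2 hne
      refine Summable.of_norm_bounded_eventually_nat (hsum.mul_left c⁻¹) ?_
      filter_upwards [h0.eventually_norm_dilateLp hf (P := fun x y => c * x ≤ y) hlow] with n hn
      rw [pow_one, Real.norm_eq_abs, abs_abs, le_inv_mul_iff₀ hc]
      exact hn
    -- All nonzero exceptional points are treated as possible jumps; `f` is locally bounded at each
    -- of them.
    · obtain ⟨A, C, hAC⟩ := exists_norm_dilateLp_sub_sq_le hf hf' hS hfS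
        (hS.toFinset.filter fun d => d ≠ 0) (fun d hd => (Finset.mem_filter.1 hd).2)
        (fun t ht htT => (hfS.hasDerivAt_of_notMem_finite hS fun htS =>
          htT (Finset.mem_filter.2 ⟨hS.mem_toFinset.2 htS, ht⟩)).continuousAt)
        (fun d hd => exists_eventually_abs_le hf' hS hfS (Finset.mem_filter.1 hd).2)
      refine Summable.of_norm_bounded_eventually_nat
        (hs.mul_left (|A| + |∑ d ∈ hS.toFinset.filter fun d => d ≠ 0, C d|)) ?_
      -- Once the differences are below `1`, the quadratic term is absorbed into the linear one.
      have hsmall : ∀ᶠ n in atTop, |Real.log (weightRatio u v n) - Real.log a| < 1 := by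
        have := h0.abs
        rw [abs_zero] at this
        exact this.eventually (gt_mem_nhds one_pos)
      filter_upwards [hsmall, h0.eventually_norm_dilateLp hf (P := fun x y =>
        y ≤ A * x ^ 2 + (∑ d ∈ hS.toFinset.filter fun d => d ≠ 0, C d) * x) hAC] with n hn1 hn
      rw [Real.norm_of_nonneg (sq_nonneg _), pow_one, add_mul]
      have hx := abs_nonneg (Real.log (weightRatio u v n) - Real.log a)
      refine hn.trans (add_le_add ?_ (mul_le_mul_of_nonneg_right (le_abs_self _) hx))
      calc _ ≤ |A| * |Real.log (weightRatio u v n) - Real.log a| ^ 2 :=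
            mul_le_mul_of_nonneg_right (le_abs_self _) (sq_nonneg _)
        _ ≤ _ := mul_le_mul_of_nonneg_left (by nlinarith) (abs_nonneg _)
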